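/- **Theorem (Lipschitz bound for a superquadratic mean-field game).** Let $d\ge 2$, let $\mathbb T^d=\mathbb R^d/\mathbb Z^d$, let $T>0$, and consider $H:\mathbb T^d\times\mathbb R^d\to\mathbb R$, $g:[0,\infty)\to\mathbb R$ and $u_T,m_0:\mathbb T^d\to\mathbb R$ such that 1. $H\in C^\infty$, $p\mapsto H(x,p)$ is strictly convex, $\lim_{|p|\to\infty}H(x,p)/|p|=+\infty$ for every $x$, and $H\ge 1$; 2. $g$ is non-negative and increasing; $u_T,m_0\in C^\infty(\mathbb T^d)$, $m_0\ge 0$, $\int_{\mathbb T^d}m_0=1$; 3. $D_pH(x,p)\cdot p-H(x,p)\ge c\,H(x,p)-C$ for some $c,C>0$; 4. $g(z)=z^\alpha$ for some $\alpha>0$; 5. $|D_xH|,\ |D^2_{xx}H|\le CH+C$ for some $C$, and for every $\delta>0$ there is $C_\delta$ such that $\operatorname{tr}(D^2_{px}H\,M)\le\delta\operatorname{tr}(D^2_{pp}H\,M^2)+C_\delta H$ for every symmetric matrix $M$; 6. $m_0\ge\kappa_0$ for some $\kappa_0>0$; 7. for some $0<\mu<1$ and non-negative constants $c_i,C_i$,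 $\;c_1|p|^{2+\mu}+C_1\le H(x,p)\le c_2|p|^{2+\mu}+C_2$; 8. $|D_pH(x,p)|^2\le C|p|^\mu H(x,p)+C$ for some $C$; 9. for some $C$, $|D^2_{xp}H|^2\le CH^{\frac{2+2\mu}{2+\mu}}$, and $|D^2_{pp}H\,M|^2\le C H^{\frac{\mu}{2+\mu}}\operatorname{tr}(D^2_{pp}H\,M\,M)$ for every symmetric matrix $M$. Let $\eta\in C_c^\infty(\mathbb R^d)$ be a mollifier: $\eta\ge0$, $\eta(-x)=\eta(x)$, $\operatorname{supp}\eta\subset \overline{B_1}$, $\int\eta=1$. Put $\eta_\epsilon(x)=\epsilon^{-d}\eta(x/\epsilon)$ and $g_\epsilon(m)=\eta_\epsilon*g(\eta_\epsilon*m)$ for $\epsilon>0$, and $g_0(m)=g(m)$. Then for every $p\in(d,\infty]$ there is a constant $C$ such that for every $\epsilon\ge 0$ and every $C^\infty$ solution $(u^\epsilon,m^\epsilon)$, $m^\epsilon\ge 0$, on $\mathbb T^d\times[0,T]$ of $$\begin{cases}-u^\epsilon_t+H(x,Du^\epsilon)=\Delta u^\epsilon+g_\epsilon(m^\epsilon),\\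 m^\epsilon_t-\operatorname{div}\big(D_pH(x,Du^\epsilon)\,m^\epsilon\big)=\Delta m^\epsilon,\end{cases}\qquad u^\epsilon(\cdot,T)=u_T,\quad m^\epsilon(\cdot,0)=m_0,$$ one has $$\|Du^\epsilon\|_{L^\infty(0,T;L^\infty)}\le C+C\,\|g_\epsilon(m^\epsilon)\|_{L^\infty(0,T;L^p)}^{\frac1{1-\mu}}+C\,\|g_\epsilon(m^\epsilon)\|_{L^\infty(0,T;L^p)}^{\frac1{1-\mu}}\,\|u^\epsilon\|_{L^\infty(0,T;L^\infty)}^{\frac1{1-\mu}},$$ where all space norms are over $\mathbb T^d$. In particular, $C$ does not depend on $\epsilon$ or on the solution. -/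

import Mathlib

open Set Filter Topology MeasureTheory
open scoped ENNReal NNReal ContDiff Gradient Laplacian Convolution

noncomputable section

/-- The Euclidean space `ℝ^d`.  Functions on the flat torus `ℝ^d / ℤ^d` are functions on `ℝ^d`
that are `1`-periodic in every coordinate. -/
abbrev Space (d : ℕ) : Type := EuclideanSpace ℝ (Fin d)

/-- `f` is `ℤ^d`-periodic, that is, a function on the torus. -/
def TorusPeriodic {d : ℕ} {β : Type*} (f : Space d → β) : Prop :=
  ∀ (i : Fin d) (x : Space d), f (x + EuclideanSpace.single i 1) = f x

/-- The unit cell `[0,1)^d`, a fundamental domain of the torus. -/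
def unitCell (d : ℕ) : Set (Space d) := {x | ∀ i, x i ∈ Ico (0 : ℝ) 1}

/-- Lebesgue measure on the torus, seen on the unit cell. -/
def torusMeasure (d : ℕ) : Measure (Space d) := volume.restrict (unitCell d)

/-- The norm of `L^∞(0,T; L^p(torus))`. -/
def mixedNorm {d : ℕ} {F : Type*} [NormedAddCommGroup F] (T : ℝ) (p : ℝ≥0∞)
    (f : ℝ → Space d → F) : ℝ≥0∞ :=
  essSup (fun t => eLpNorm (f t) p (torusMeasure d)) (volume.restrict (Ioo 0 T))

/-- The `i`-th partial derivative. -/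
def partialDeriv {d : ℕ} (i : Fin d) (f : Space d → ℝ) (x : Space d) : ℝ :=
  fderiv ℝ f x (EuclideanSpace.single i 1)

/-- The divergence of a vector field. -/
def divergence {d : ℕ} (F : Space d → Space d) (x : Space d) : ℝ :=
  ∑ i, partialDeriv i (fun y => F y i) x

/-- The Euclidean (Frobenius) norm of a matrix. -/
def matNorm {d : ℕ} (A : Matrix (Fin d) (Fin d) ℝ) : ℝ :=
  Real.sqrt (∑ i, ∑ j, A i j ^ 2)

/-! ### Derivatives of a Hamiltonian `H (x, p)` -/

/-- `D_x H`. -/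
def gradX {d : ℕ} (H : Space d → Space d → ℝ) (x p : Space d) : Space d :=
  ∇ (fun y => H y p) x

/-- `D_p H`. -/
def gradP {d : ℕ} (H : Space d → Space d → ℝ) (x p : Space d) : Space d :=
  ∇ (fun q => H x q) p

/-- `D²_{xx} H`. -/
def hessXX {d : ℕ} (H : Space d → Space d → ℝ) (x p : Space d) : Matrix (Fin d) (Fin d) ℝ :=
  Matrix.of fun i j => partialDeriv i (fun y => partialDeriv j (fun z => H z p) y) x

/-- `D²_{px} H`, with entries `∂_{p_i} ∂_{x_j} H`. The matrix `D²_{xp} H` is its transpose. -/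
def hessPX {d : ℕ} (H : Space d → Space d → ℝ) (x p : Space d) : Matrix (Fin d) (Fin d) ℝ :=
  Matrix.of fun i j => partialDeriv i (fun q => partialDeriv j (fun y => H y q) x) p

/-- `D²_{pp} H`. -/
def hessPP {d : ℕ} (H : Space d → Space d → ℝ) (x p : Space d) : Matrix (Fin d) (Fin d) ℝ :=
  Matrix.of fun i j => partialDeriv i (fun q => partialDeriv j (fun r => H x r) q) p

/-! ### Standing assumptions -/

/-- `H` is a smooth function on torus times `ℝ^d`, strictly convex and superlinear in `p`,
with `H ≥ 1`. -/
structure IsConvexHamiltonian {d : ℕ} (H : Space d → Space d → ℝ) : Prop where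
  periodic : ∀ p, TorusPeriodic (fun x => H x p)
  smooth : ContDiff ℝ ∞ (fun z : Space d × Space d => H z.1 z.2)
  strictConvex : ∀ x, StrictConvexOn ℝ univ (H x)
  coercive : ∀ x, Tendsto (fun p => H x p / ‖p‖) (Bornology.cobounded (Space d)) atTop
  one_le : ∀ x p, 1 ≤ H x p

/-- `g` is non-negative and increasing on `[0,∞)`; the terminal datum `uT` and the initial
density `m0` are smooth functions on the torus, and `m0` is a probability density. -/
structure IsCouplingAndData {d : ℕ} (g : ℝ → ℝ) (uT m0 : Space d → ℝ) : Prop where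
  g_nonneg : ∀ z, 0 ≤ z → 0 ≤ g z
  g_mono : MonotoneOn g (Ici 0)
  uT_periodic : TorusPeriodic uT
  uT_smooth : ContDiff ℝ ∞ uT
  m0_periodic : TorusPeriodic m0
  m0_smooth : ContDiff ℝ ∞ m0
  m0_nonneg : ∀ x, 0 ≤ m0 x
  m0_integral : ∫ x, m0 x ∂(torusMeasure d) = 1

/-- `D_pH(x,p)·p - H(x,p) ≥ c H(x,p) - C` for some `c, C > 0`. -/
def LagrangianBound {d : ℕ} (H : Space d → Space d → ℝ) : Prop :=
  ∃ c C : ℝ, 0 < c ∧ 0 < C ∧ ∀ x p, c * H x p - C ≤ inner ℝ (gradP H x p) p - H x p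

/-- `g(m) = m^α` on `[0,∞)` for the positive exponent `α`. -/
def IsPowerCoupling (g : ℝ → ℝ) (α : ℝ) : Prop :=
  0 < α ∧ ∀ z, 0 ≤ z → g z = z ^ α

/-- `|D_xH|, |D²_{xx}H| ≤ C H + C`, and for every `δ > 0` there is `C_δ` with
`tr(D²_{px}H M) ≤ δ tr(D²_{pp}H M²) + C_δ H` for all symmetric `M`. -/
structure SpatialDerivativeBounds {d : ℕ} (H : Space d → Space d → ℝ) : Prop where
  space : ∃ C : ℝ, ∀ x p, ‖gradX H x p‖ ≤ C * H x p + C ∧ matNorm (hessXX H x p) ≤ C * H x p + C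
  mixed : ∀ δ : ℝ, 0 < δ → ∃ C : ℝ, ∀ M : Matrix (Fin d) (Fin d) ℝ, M.IsSymm → ∀ x p,
    (hessPX H x p * M).trace ≤ δ * (hessPP H x p * M ^ 2).trace + C * H x p

/-- `m0` is bounded below by a positive constant. -/
def BoundedBelowDensity {d : ℕ} (m0 : Space d → ℝ) : Prop :=
  ∃ κ : ℝ, 0 < κ ∧ ∀ x, κ ≤ m0 x

/-- Superquadratic growth: `0 < μ < 1` and `c₁|p|^{2+μ} + C₁ ≤ H ≤ c₂|p|^{2+μ} + C₂`
with non-negative constants. -/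
def SuperquadraticGrowth {d : ℕ} (H : Space d → Space d → ℝ) (μ : ℝ) : Prop :=
  0 < μ ∧ μ < 1 ∧ ∃ c₁ C₁ c₂ C₂ : ℝ, 0 ≤ c₁ ∧ 0 ≤ C₁ ∧ 0 ≤ c₂ ∧ 0 ≤ C₂ ∧ ∀ x p,
    c₁ * ‖p‖ ^ (2 + μ) + C₁ ≤ H x p ∧ H x p ≤ c₂ * ‖p‖ ^ (2 + μ) + C₂

/-- `|D_pH|² ≤ C |p|^μ H + C`. -/
def MomentumGradientBound {d : ℕ} (H : Space d → Space d → ℝ) (μ : ℝ) : Prop :=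
  ∃ C : ℝ, ∀ x p, ‖gradP H x p‖ ^ 2 ≤ C * ‖p‖ ^ μ * H x p + C

/-- `|D²_{xp}H|² ≤ C H^{(2+2μ)/(2+μ)}` and, for all symmetric `M`,
`|D²_{pp}H M|² ≤ C H^{μ/(2+μ)} tr(D²_{pp}H M M)`. -/
def MomentumHessianBounds {d : ℕ} (H : Space d → Space d → ℝ) (μ : ℝ) : Prop :=
  ∃ C : ℝ, ∀ x p,
    matNorm (hessPX H x p).transpose ^ 2 ≤ C * H x p ^ ((2 + 2 * μ) / (2 + μ)) ∧
    ∀ M : Matrix (Fin d) (Fin d) ℝ, M.IsSymm →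
      matNorm (hessPP H x p * M) ^ 2 ≤
        C * H x p ^ (μ / (2 + μ)) * (hessPP H x p * M * M).trace

/-! ### The regularized mean-field game -/

/-- A standard symmetric mollifier on `ℝ^d`. -/
structure IsSymmMollifier {d : ℕ} (η : Space d → ℝ) : Prop where
  smooth : ContDiff ℝ ∞ η
  nonneg : ∀ x, 0 ≤ η x
  support : Function.support η ⊆ Metric.closedBall 0 1
  symm : ∀ x, η (-x) = η x
  integral : ∫ x, η x = 1

/-- The rescaled kernel `η_ε(x) = ε^{-d} η(x/ε)`. -/
def scaledKernel {d : ℕ} (η : Space d → ℝ) (ε : ℝ) (x : Space d) : ℝ :=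
  (ε ^ d)⁻¹ * η (ε⁻¹ • x)

/-- The regularized coupling `g_ε(m) = η_ε * g(η_ε * m)` for `ε ≠ 0`, and `g_0(m) = g(m)`.
The convolution over `ℝ^d` of `η_ε` with a periodic function is the convolution on the torus
with the periodized kernel. -/
def regCoupling {d : ℕ} (η : Space d → ℝ) (g : ℝ → ℝ) (ε : ℝ) (m : Space d → ℝ) : Space d → ℝ :=
  if ε = 0 then fun x => g (m x)
  else scaledKernel η ε ⋆ fun x => g ((scaledKernel η ε ⋆ m) x)

/-- `(u, m)` is a smooth solution on torus times `[0,T]` of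
`-u_t + H(x,Du) = Δu + g_ε(m)`, `m_t - div(D_pH(x,Du) m) = Δm`,
with `u(·,T) = uT` and `m(·,0) = m0`. The time variable is the first argument. The density `m` is
non-negative, since `g` is a function on `[0,∞)`. -/
structure IsRegMFGSolution {d : ℕ} (H : Space d → Space d → ℝ) (g : ℝ → ℝ) (uT m0 : Space d → ℝ)
    (T : ℝ) (η : Space d → ℝ) (ε : ℝ) (u m : ℝ → Space d → ℝ) : Prop where
  u_periodic : ∀ t ∈ Icc 0 T, TorusPeriodic (u t)
  m_periodic : ∀ t ∈ Icc 0 T, TorusPeriodic (m t)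
  u_smooth : ContDiffOn ℝ ∞ (fun z : ℝ × Space d => u z.1 z.2) (Icc 0 T ×ˢ univ)
  m_smooth : ContDiffOn ℝ ∞ (fun z : ℝ × Space d => m z.1 z.2) (Icc 0 T ×ˢ univ)
  m_nonneg : ∀ t ∈ Icc 0 T, ∀ x, 0 ≤ m t x
  hamiltonJacobi : ∀ t ∈ Ioo 0 T, ∀ x,
    -deriv (fun s => u s x) t + H x (∇ (u t) x) = Δ (u t) x + regCoupling η g ε (m t) x
  fokkerPlanck : ∀ t ∈ Ioo 0 T, ∀ x,
    deriv (fun s => m s x) t - divergence (fun y => m t y • gradP H y (∇ (u t) y)) x = Δ (m t) x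
  terminal : ∀ x, u T x = uT x
  initial : ∀ x, m 0 x = m0 x

end

/-! The estimate is a Bernstein argument without second derivatives. Fix a direction `ξ` with `|ξ| ≤
1` and put `v = ∂_ξ u`, `b = D_pH(x,Du)`, `G = g_ε(m)`. Differentiating the Hamilton-Jacobi equation
gives `-v_t - Δv = ∂_ξ G - D_xH·ξ - b·Dv`. Subtracting `l u` produces the term `-l (b·Du - H)`,
which the Lagrangian bound makes at most `-l c H` up to a constant; `G` enters through `-l G ≤ 0`.
If `|b|² ≤ K H` along the solution, then a multiple `θ` of `v - l u`, corrected by a constant and a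
linear function of time, satisfies `-W_t - ΔW ≤ ¼|DW|² + ∂_ξ(θG)` with `W(T) ≤ 0`: the good term `-θ
l c H = -2K H` pays both for Young's inequality on `b·DW` and for `D_xH`. This is
`IsRegMFGSolution.isBackwardSubsolution`.

Choosing `l` so large that `‖θG‖_p ≤ 1`, the problem is to bound `W` above by a constant depending
only on `d`, `p`, `T`. This is `exists_backward_subsolution_le`, a Moser iteration on exponentials:
testing with `e^{qW}`, moving the derivative off the source, and using Sobolev and Hölder with `p >
d` give `-y_q' + y_q ≤ C q^N y_{q/2}²` for `y_q = ∫ e^{qW}`. Along `q = 2^k` this yields the sup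
bound.

With `M = sup |Du|`, the bound on `D_pH` allows `K` of order `1 + M^μ`, hence `l` of order `1 + (1 +
M^μ) N`, where `N` is the mixed norm of the coupling. Undoing the change of unknown and choosing `ξ`
along `Du` gives `M ≤ L + l (U + A)`, with `U` the sup norm of `u`. As `μ < 1`, the power `M^μ` is
absorbed, whence the exponent `1/(1-μ)`. The terms not multiplied by `N` are harmless because `m₀ ≥
κ₀ > 0` and continuity at `t = 0` bound `N` below uniformly in `ε` and the solution
(`rpow_le_mixedNorm_regCoupling`). All dependence on `ε` goes through `N` and `U`. -/

open scoped Pointwise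

/-! ### The unit cell as a fundamental domain -/

/-- The standard basis of `ℝ^d`. -/
noncomputable abbrev stdBasis (d : ℕ) : Module.Basis (Fin d) ℝ (Space d) :=
  (EuclideanSpace.basisFun (Fin d) ℝ).toBasis

/-- The lattice `ℤ^d`. -/
noncomputable abbrev stdLattice (d : ℕ) : Submodule ℤ (Space d) :=
  Submodule.span ℤ (range (stdBasis d))

/-- The closed unit cube `[0,1]^d`. -/
def closedCell (d : ℕ) : Set (Space d) := {x | ∀ i, x i ∈ Icc (0 : ℝ) 1}

lemma unitCell_eq_fundamentalDomain (d : ℕ) :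
    unitCell d = ZSpan.fundamentalDomain (stdBasis d) := by
  ext x
  simp [unitCell, ZSpan.mem_fundamentalDomain, stdBasis]

lemma isAddFundamentalDomain_unitCell (d : ℕ) :
    IsAddFundamentalDomain (stdLattice d) (unitCell d) volume := by
  rw [unitCell_eq_fundamentalDomain]
  exact ZSpan.isAddFundamentalDomain _ _

lemma measurableSet_unitCell (d : ℕ) : MeasurableSet (unitCell d) := by
  rw [unitCell_eq_fundamentalDomain]
  exact ZSpan.fundamentalDomain_measurableSet _

lemma TorusPeriodic.add_lattice {d : ℕ} {β : Type*} {f : Space d → β} (hf : TorusPeriodic f)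
    {v : Space d} (hv : v ∈ stdLattice d) (x : Space d) : f (v + x) = f x := by
  induction hv using Submodule.span_induction generalizing x with
  | mem y hy =>
    obtain ⟨i, rfl⟩ := hy
    rw [add_comm]
    simpa [stdBasis] using hf i x
  | zero => simp
  | add y z _ _ hy hz => rw [add_assoc, hy, hz]
  | smul n y _ hy =>
    induction n using Int.induction_on generalizing x with
    | zero => simp
    | succ n ih => rw [add_smul, one_smul, add_assoc, ih, hy]
    | pred n ih =>
      have := ih (x - y)
      rw [← hy (x - y), add_sub_cancel] at this
      rw [sub_smul, one_smul, ← this]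
      congr 1
      abel

lemma TorusPeriodic.exists_mem_unitCell {d : ℕ} {β : Type*} {f : Space d → β}
    (hf : TorusPeriodic f) (x : Space d) : ∃ y ∈ unitCell d, f y = f x := by
  obtain ⟨v, hv, -⟩ := ZSpan.exist_unique_vadd_mem_fundamentalDomain (stdBasis d) x
  refine ⟨v +ᵥ x, by rwa [unitCell_eq_fundamentalDomain], ?_⟩
  exact hf.add_lattice v.2 x

lemma isCompact_closedCell (d : ℕ) : IsCompact (closedCell d) := by
  have h : closedCell d = (EuclideanSpace.equiv (Fin d) ℝ) ⁻¹' (Icc 0 1) := by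
    ext x
    simp [closedCell, Pi.le_def, forall_and]
  rw [h]
  exact (EuclideanSpace.equiv (Fin d) ℝ).toHomeomorph.isCompact_preimage.2 isCompact_Icc

lemma unitCell_subset_closedCell (d : ℕ) : unitCell d ⊆ closedCell d :=
  fun _ hx i => ⟨(hx i).1, (hx i).2.le⟩

lemma volume_unitCell (d : ℕ) : volume (unitCell d) = 1 := by
  have h : unitCell d = (MeasurableEquiv.toLp 2 (Fin d → ℝ)).symm ⁻¹'
      (Set.pi univ fun _ => Ico (0 : ℝ) 1) := by
    ext x
    simp [unitCell]
  rw [h, (EuclideanSpace.volume_preserving_symm_measurableEquiv_toLp (Fin d)).measure_preimage_equiv]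
  simp [volume_pi_pi]

instance isProbabilityMeasure_torusMeasure (d : ℕ) : IsProbabilityMeasure (torusMeasure d) :=
  ⟨by simp [torusMeasure, volume_unitCell]⟩

/-- The center of the unit cell. -/
noncomputable def cellCenter (d : ℕ) : Space d := WithLp.toLp 2 fun _ => 1 / 2

lemma unitCell_mem_nhds (d : ℕ) : unitCell d ∈ 𝓝 (cellCenter d) := by
  have h : (⋂ i, {x : Space d | x i ∈ Ioo (0 : ℝ) 1}) ∈ 𝓝 (cellCenter d) := by
    rw [Filter.iInter_mem]
    intro i
    have hc : Continuous fun x : Space d => x i := by fun_prop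
    refine hc.continuousAt.preimage_mem_nhds (Ioo_mem_nhds ?_ ?_) <;> norm_num [cellCenter]
  refine mem_of_superset h fun x hx i => ?_
  have := mem_iInter.1 hx i
  exact ⟨this.1.le, this.2⟩

lemma Continuous.integrable_torus {d : ℕ} {F : Type*} [NormedAddCommGroup F] {f : Space d → F}
    (hf : Continuous f) : Integrable f (torusMeasure d) :=
  (hf.continuousOn.integrableOn_compact (isCompact_closedCell d)).mono_set
    (unitCell_subset_closedCell d)

instance (d : ℕ) : VAddInvariantMeasure (stdLattice d) (Space d) volume :=
  inferInstanceAs (VAddInvariantMeasure (stdLattice d).toAddSubgroup (Space d) volume)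

lemma isAddFundamentalDomain_vadd_unitCell {d : ℕ} (v : Space d) :
    IsAddFundamentalDomain (stdLattice d) (v +ᵥ unitCell d) volume :=
  (isAddFundamentalDomain_unitCell d).vadd_of_comm v

lemma TorusPeriodic.setLIntegral_vadd {d : ℕ} {f : Space d → ℝ≥0∞} (hf : TorusPeriodic f)
    (v : Space d) : ∫⁻ x in v +ᵥ unitCell d, f x = ∫⁻ x, f x ∂(torusMeasure d) :=
  (isAddFundamentalDomain_vadd_unitCell v).setLIntegral_eq (isAddFundamentalDomain_unitCell d) f
    fun g x => hf.add_lattice g.2 x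

lemma TorusPeriodic.integral_comp_add {d : ℕ} {F : Type*} [NormedAddCommGroup F] [NormedSpace ℝ F]
    {f : Space d → F} (hf : TorusPeriodic f) (v : Space d) :
    ∫ x, f (v + x) ∂(torusMeasure d) = ∫ x, f x ∂(torusMeasure d) := by
  have h1 : ∫ x in v +ᵥ unitCell d, f x = ∫ x, f x ∂(torusMeasure d) :=
    (isAddFundamentalDomain_vadd_unitCell v).setIntegral_eq (isAddFundamentalDomain_unitCell d)
      fun g x => hf.add_lattice g.2 x
  rw [← h1]
  exact ((measurePreserving_add_left volume v).setIntegral_image_emb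
    (measurableEmbedding_addLeft v) f (unitCell d)).symm

lemma TorusPeriodic.exists_bound {d : ℕ} {F : Type*} [NormedAddCommGroup F] {f : Space d → F}
    (hf : TorusPeriodic f) (hc : Continuous f) : ∃ C, ∀ x, ‖f x‖ ≤ C := by
  obtain ⟨C, hC⟩ := (isCompact_closedCell d).exists_bound_of_continuousOn hc.continuousOn
  refine ⟨C, fun x => ?_⟩
  obtain ⟨y, hy, h⟩ := hf.exists_mem_unitCell x
  rw [← h]
  exact hC y (unitCell_subset_closedCell d hy)

/-- The integral of a periodic function over a compact set is controlled by that over the torus. -/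
lemma exists_setLIntegral_le_torus {d : ℕ} {B : Set (Space d)} (hB : IsCompact B) :
    ∃ n : ℕ, ∀ f : Space d → ℝ≥0∞, TorusPeriodic f →
      ∫⁻ x in B, f x ≤ n * ∫⁻ x, f x ∂(torusMeasure d) := by
  obtain ⟨t, ht⟩ := hB.elim_nhds_subcover (fun x => (x - cellCenter d) +ᵥ unitCell d) (by
    intro x _
    have h := vadd_mem_nhds_vadd (x - cellCenter d) (unitCell_mem_nhds d)
    simpa using h)
  refine ⟨t.card, fun f hf => ?_⟩
  calc ∫⁻ x in B, f x ≤ ∫⁻ x in ⋃ y ∈ t, (y - cellCenter d) +ᵥ unitCell d, f x :=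
        lintegral_mono_set ht.2
    _ ≤ ∑ y ∈ t, ∫⁻ x in (y - cellCenter d) +ᵥ unitCell d, f x := by
        rw [← Finset.tsum_subtype]
        have : (⋃ y ∈ t, (y - cellCenter d) +ᵥ unitCell d)
          = ⋃ y : t, (y.1 - cellCenter d) +ᵥ unitCell d := by
          simp [iUnion_subtype]
        rw [this]
        exact lintegral_iUnion_le _ _
    _ = _ := by simp [hf.setLIntegral_vadd]

/-- Differentiation under the integral over the torus. -/
lemma hasDerivAt_torus_integral {d : ℕ} {f f' : ℝ → Space d → ℝ} {s : Set ℝ} (hs : IsOpen s)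
    {t : ℝ} (ht : t ∈ s) (hf' : ContinuousOn (fun z : ℝ × Space d => f' z.1 z.2) (s ×ˢ univ))
    (hf : ∀ τ ∈ s, Continuous (f τ)) (hd : ∀ τ ∈ s, ∀ x, HasDerivAt (fun r => f r x) (f' τ x) τ) :
    HasDerivAt (fun τ => ∫ x, f τ x ∂(torusMeasure d)) (∫ x, f' t x ∂(torusMeasure d)) t := by
  obtain ⟨r, hr, hrs⟩ := Metric.isOpen_iff.1 hs t ht
  have hsub : Metric.closedBall t (r / 2) ⊆ s :=
    (Metric.closedBall_subset_ball (by linarith)).trans hrs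
  obtain ⟨C, hC⟩ := ((isCompact_closedBall t (r / 2)).prod
    (isCompact_closedCell d)).exists_bound_of_continuousOn
    (hf'.mono (prod_mono hsub (subset_univ _)))
  have hcont : Continuous (f' t) := by
    rw [← continuousOn_univ]
    exact hf'.comp (f := fun x => (t, x)) (by fun_prop) fun x _ => ⟨ht, mem_univ _⟩
  refine (hasDerivAt_integral_of_dominated_loc_of_deriv_le (bound := fun _ => C)
    (Metric.ball_mem_nhds t (half_pos hr)) ?_ (hf t ht).integrable_torus
    hcont.aestronglyMeasurable ?_ (integrable_const C) ?_).2
  · filter_upwards [hs.mem_nhds ht] with τ hτ using (hf τ hτ).aestronglyMeasurable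
  · refine (ae_restrict_iff' (measurableSet_unitCell d)).2 (Eventually.of_forall fun x hx τ hτ => ?_)
    exact hC (τ, x) ⟨Metric.ball_subset_closedBall hτ, unitCell_subset_closedCell d hx⟩
  · exact Eventually.of_forall fun x τ hτ => hd τ (hsub (Metric.ball_subset_closedBall hτ)) x

lemma continuousOn_torus_integral {d : ℕ} {f : ℝ → Space d → ℝ} {a b : ℝ}
    (hf : ContinuousOn (fun z : ℝ × Space d => f z.1 z.2) (Ioc a b ×ˢ univ)) :
    ContinuousOn (fun τ => ∫ x, f τ x ∂(torusMeasure d)) (Ioc a b) := by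
  intro t ht
  have hK : Icc ((a + t) / 2) b ⊆ Ioc a b := fun y hy => ⟨by linarith [hy.1, ht.1], hy.2⟩
  obtain ⟨C, hC⟩ := (isCompact_Icc.prod (isCompact_closedCell d)).exists_bound_of_continuousOn
    (hf.mono (prod_mono hK (subset_univ _)))
  have hsec : ∀ τ ∈ Ioc a b, Continuous (f τ) := fun τ hτ => by
    rw [← continuousOn_univ]
    exact hf.comp (f := fun x => (τ, x)) (by fun_prop) fun x _ => ⟨hτ, mem_univ _⟩
  have hnear : ∀ᶠ τ in 𝓝[Ioc a b] t, τ ∈ Icc ((a + t) / 2) b := by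
    have h1 : Ioi ((a + t) / 2) ∈ 𝓝 t := Ioi_mem_nhds (by linarith [ht.1])
    filter_upwards [mem_nhdsWithin_of_mem_nhds h1, self_mem_nhdsWithin] with τ h1 h2
    exact ⟨le_of_lt h1, h2.2⟩
  refine continuousWithinAt_of_dominated (bound := fun _ => C) ?_ ?_ (integrable_const C) ?_
  · filter_upwards [self_mem_nhdsWithin] with τ hτ using (hsec τ hτ).aestronglyMeasurable
  · filter_upwards [hnear] with τ hτ
    refine (ae_restrict_iff' (measurableSet_unitCell d)).2 (Eventually.of_forall fun x hx => ?_)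
    exact hC (τ, x) ⟨hτ, unitCell_subset_closedCell d hx⟩
  · refine Eventually.of_forall fun x => ?_
    exact (hf (t, x) ⟨ht, mem_univ _⟩).comp (f := fun τ => (τ, x))
      (Continuous.continuousWithinAt (by fun_prop)) fun τ hτ => ⟨hτ, mem_univ _⟩

/-- Integration by parts on the torus, in the form that derivatives have mean zero. -/
lemma TorusPeriodic.integral_fderiv {d : ℕ} {f : Space d → ℝ} (hf : TorusPeriodic f)
    (hc : ContDiff ℝ 1 f) (ξ : Space d) : ∫ x, fderiv ℝ f x ξ ∂(torusMeasure d) = 0 := by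
  have hcd : Continuous (fderiv ℝ f) := hc.continuous_fderiv (by norm_num)
  have h := hasDerivAt_torus_integral (d := d) (f := fun s x => f (s • ξ + x))
    (f' := fun s x => fderiv ℝ f (s • ξ + x) ξ) (s := univ) isOpen_univ (t := 0) (mem_univ _)
    (Continuous.continuousOn (by fun_prop)) (fun τ _ => hc.continuous.comp (by fun_prop))
    (fun τ _ x => by
      have h1 : HasDerivAt (fun r : ℝ => r • ξ + x) ξ τ := by
        simpa using ((hasDerivAt_id τ).smul_const ξ).add_const x
      exact ((hc.differentiable (by norm_num)) _).hasFDerivAt.comp_hasDerivAt τ h1)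
  have h2 : (fun τ : ℝ => ∫ x, f (τ • ξ + x) ∂(torusMeasure d)) =
      fun _ => ∫ x, f x ∂(torusMeasure d) := funext fun τ => hf.integral_comp_add _
  rw [h2] at h
  simpa using h.unique (hasDerivAt_const _ _)

/-! ### Sobolev and interpolation inequalities on the torus -/

lemma TorusPeriodic.fderiv {d : ℕ} {F : Type*} [NormedAddCommGroup F] [NormedSpace ℝ F]
    {f : Space d → F} (hf : TorusPeriodic f) : TorusPeriodic (fderiv ℝ f) := by
  intro i x
  rw [← fderiv_comp_add_right]
  congr 1
  exact funext fun y => hf i y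

/-- The energy `‖Dz‖² + ‖z‖²` of a function on the torus. -/
noncomputable def torusEnergy {d : ℕ} (z : Space d → ℝ) : ℝ≥0∞ :=
  ∫⁻ x, ‖fderiv ℝ z x‖ₑ ^ 2 ∂(torusMeasure d) + ∫⁻ x, ‖z x‖ₑ ^ 2 ∂(torusMeasure d)

/-- Multiply by a cutoff equal to 1 on the cell, apply Gagliardo-Nirenberg-Sobolev on `ℝ^d`, and
return to the torus by covering the support of the cutoff with finitely many translated cells. -/
lemma torus_sobolev {d : ℕ} (hd : 2 ≤ d) {s : ℝ} (hs : 2 ≤ s) (hsd : 1 / 2 - 1 / (d : ℝ) < 1 / s) :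
    ∃ C : ℝ≥0, ∀ z : Space d → ℝ, ContDiff ℝ 1 z → TorusPeriodic z →
      eLpNorm z (ENNReal.ofReal s) (torusMeasure d) ^ 2 ≤ C * torusEnergy z := by
  have hd0 : (2 : ℝ) ≤ d := by exact_mod_cast hd
  obtain ⟨R, hR0, hR⟩ := (isCompact_closedCell d).isBounded.subset_closedBall_lt 0 0
  let χ : ContDiffBump (0 : Space d) := ⟨R, R + 1, hR0, by linarith⟩
  have hχc : ContDiff ℝ 1 χ := χ.contDiff
  have hχs : tsupport χ = Metric.closedBall 0 (R + 1) := χ.tsupport_eq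
  have hχcs : HasCompactSupport χ := χ.hasCompactSupport
  obtain ⟨L, hL⟩ := (hχcs.fderiv (𝕜 := ℝ)).exists_bound_of_continuous
    (hχc.continuous_fderiv (by norm_num))
  have hL0 : 0 ≤ L := (norm_nonneg _).trans (hL 0)
  set B : Set (Space d) := Metric.closedBall 0 (R + 1) with hB
  have hBc : IsCompact B := isCompact_closedBall _ _
  obtain ⟨n, hn⟩ := exists_setLIntegral_le_torus hBc
  -- `a` is the exponent whose Sobolev conjugate is `s`. It lies in `[1,2]`, so Hölder on the
  -- bounded set `B` passes from `L^a` to `L²`; this treats `d = 2` together with higher dimensions.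
  set a : ℝ≥0 := (1 / s + 1 / (d : ℝ))⁻¹.toNNReal with ha
  have hs0 : 0 < 1 / s := by positivity
  have hdi : 0 < 1 / (d : ℝ) := by positivity
  have haR : (a : ℝ) = (1 / s + 1 / (d : ℝ))⁻¹ := Real.coe_toNNReal _ (by positivity)
  have hs2 : 1 / s ≤ 1 / 2 := one_div_le_one_div_of_le (by norm_num) hs
  have hd2 : 1 / (d : ℝ) ≤ 1 / 2 := one_div_le_one_div_of_le (by norm_num) hd0
  have ha1 : 1 ≤ a := by
    rw [← NNReal.coe_le_coe, haR]
    exact (one_le_inv₀ (by positivity)).2 (by linarith)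
  have ha2 : a ≤ 2 := by
    rw [← NNReal.coe_le_coe, haR, inv_le_comm₀ (by positivity) (by norm_num)]
    push_cast
    linarith
  set S : ℝ≥0 := SNormLESNormFDerivOfEqConst ℝ (volume : Measure (Space d)) a
  set V : ℝ≥0∞ := volume B ^ (1 / (a : ℝ) - 1 / 2)
  have hVtop : V ≠ (⊤ : ℝ≥0∞) := ENNReal.rpow_ne_top_of_nonneg (y := 1 / (a : ℝ) - 1 / 2) (by
    rw [haR, one_div, inv_inv]; linarith) hBc.measure_lt_top.ne
  refine ⟨(S * V.toNNReal) ^ 2 * (n * (2 * (1 + L.toNNReal ^ 2))), fun z hz hzp => ?_⟩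
  have hfc : ContDiff ℝ 1 (fun x => χ x * z x) := hχc.mul hz
  have hfs : HasCompactSupport (fun x => χ x * z x) := hχcs.mul_right
  have hzd : Continuous (fderiv ℝ z) := hz.continuous_fderiv (by norm_num)
  set h : Space d → ℝ := fun x => ‖fderiv ℝ z x‖ + L * ‖z x‖ with hh
  have hhc : Continuous h := by have := hz.continuous; fun_prop
  have h1 : eLpNorm z (ENNReal.ofReal s) (torusMeasure d) ≤
      eLpNorm (fun x => χ x * z x) (ENNReal.ofReal s) volume := by
    refine le_trans (le_of_eq ?_) (eLpNorm_restrict_le _ _ _ (unitCell d))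
    refine eLpNorm_congr_ae ?_
    refine (ae_restrict_iff' (measurableSet_unitCell d)).2 (Eventually.of_forall fun x hx => ?_)
    have : χ x = 1 := χ.one_of_mem_closedBall (hR (unitCell_subset_closedCell d hx))
    simp [this]
  have h2 : eLpNorm (fun x => χ x * z x) (ENNReal.ofReal s) volume ≤
      S * eLpNorm (fderiv ℝ fun x => χ x * z x) a volume := by
    have := eLpNorm_le_eLpNorm_fderiv_of_eq (μ := (volume : Measure (Space d)))
      (p := a) (p' := s.toNNReal) hfc hfs ha1
      (by rw [finrank_euclideanSpace_fin]; omega) (by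
        rw [finrank_euclideanSpace_fin, Real.coe_toNNReal _ (by linarith), NNReal.coe_inv, haR]
        simp)
    exact this
  have h3 : eLpNorm (fderiv ℝ fun x => χ x * z x) a volume ≤ eLpNorm h a (volume.restrict B) := by
    rw [← eLpNorm_indicator_eq_eLpNorm_restrict measurableSet_closedBall]
    refine eLpNorm_mono fun x => ?_
    by_cases hx : x ∈ B
    · rw [indicator_of_mem hx, fderiv_fun_mul (hχc.differentiable (by norm_num) x)
        (hz.differentiable (by norm_num) x), Real.norm_of_nonneg (by positivity)]
      refine (norm_add_le _ _).trans (add_le_add ?_ ?_)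
      · rw [norm_smul, Real.norm_of_nonneg χ.nonneg]
        exact mul_le_of_le_one_left (norm_nonneg _) χ.le_one
      · rw [norm_smul, mul_comm]
        exact mul_le_mul_of_nonneg_right (hL x) (norm_nonneg _)
    · have h0 : x ∉ tsupport (fun x => χ x * z x) := fun hc => hx (by
        rw [← hχs]
        exact tsupport_mul_subset_left hc)
      rw [fderiv_of_notMem_tsupport ℝ h0]
      simp
  have h4 : eLpNorm h a (volume.restrict B) ≤ eLpNorm h 2 (volume.restrict B) * V := by
    have := eLpNorm_le_eLpNorm_mul_rpow_measure_univ (μ := volume.restrict B) (f := h)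
      (p := a) (q := 2) (by exact_mod_cast ha2) hhc.aestronglyMeasurable
    simpa [V] using this
  have h5 : eLpNorm h 2 (volume.restrict B) ^ 2 ≤
      n * (2 * (1 + L.toNNReal ^ 2)) * torusEnergy z := by
    have e1 : eLpNorm h 2 (volume.restrict B) ^ 2 = ∫⁻ x in B, ‖h x‖ₑ ^ 2 := by
      rw [eLpNorm_eq_lintegral_rpow_enorm_toReal (by norm_num) (by norm_num), ← ENNReal.rpow_natCast,
        ← ENNReal.rpow_mul]
      simp
    rw [e1]
    have e2 : ∀ x, ‖h x‖ₑ ^ 2 ≤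
        2 * (1 + L.toNNReal ^ 2 : ℝ≥0∞) * (‖fderiv ℝ z x‖ₑ ^ 2 + ‖z x‖ₑ ^ 2) := by
      intro x
      have e3 : h x ^ 2 ≤ 2 * (1 + L ^ 2) * (‖fderiv ℝ z x‖ ^ 2 + ‖z x‖ ^ 2) := by
        simp only [hh]
        nlinarith [sq_nonneg (‖fderiv ℝ z x‖ - L * ‖z x‖), sq_nonneg (L * ‖fderiv ℝ z x‖),
          sq_nonneg ‖z x‖]
      have e4 := ENNReal.ofReal_le_ofReal e3
      rw [ENNReal.ofReal_mul (by positivity), ENNReal.ofReal_mul (by positivity),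
        ENNReal.ofReal_add (by positivity) (by positivity),
        ENNReal.ofReal_add (by positivity) (by positivity), ENNReal.ofReal_pow hL0,
        ENNReal.ofReal_pow (norm_nonneg _), ENNReal.ofReal_pow (norm_nonneg _),
        ENNReal.ofReal_pow (by positivity)] at e4
      rw [Real.enorm_of_nonneg (by positivity : 0 ≤ h x), ← ofReal_norm, ← ofReal_norm]
      rw [ENNReal.ofReal_one, ENNReal.ofReal_ofNat] at e4
      exact e4
    refine (lintegral_mono e2).trans ?_
    rw [lintegral_const_mul _ (by have := hz.continuous; fun_prop)]
    refine (mul_le_mul_right (hn _ fun i x => by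
      simp only [hzp.fderiv i x, hzp i x]) _).trans (le_of_eq ?_)
    rw [torusEnergy, lintegral_add_left (by fun_prop)]
    ring
  calc eLpNorm z (ENNReal.ofReal s) (torusMeasure d) ^ 2
      ≤ (S * (eLpNorm h 2 (volume.restrict B) * V)) ^ 2 := by
        refine pow_le_pow_left' (h1.trans (h2.trans ?_)) 2
        exact mul_le_mul_right (h3.trans h4) _
    _ = (S * V) ^ 2 * eLpNorm h 2 (volume.restrict B) ^ 2 := by ring
    _ ≤ (S * V) ^ 2 * (n * (2 * (1 + L.toNNReal ^ 2)) * torusEnergy z) := mul_le_mul_right h5 _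
    _ = _ := by
        push_cast
        rw [ENNReal.coe_toNNReal hVtop]
        ring

/-- Three-factor Hölder applied to `G² z² = (|G|^p)^{2/p} (|z|^s)^a |z|^b`. Since `s a = 2 - b`, the
middle factor is the power `1 - b/2` of `‖z‖_s²`. -/
lemma torus_hoelder_interpolation {d : ℕ} {p s : ℝ} (hp : 2 < p) (hs1 : 1 < s)
    {a b : ℝ} (ha : 0 ≤ a) (hb : 0 ≤ b) (hab : 2 / p + a + b = 1) (hsab : s * a + b = 2)
    {G z : Space d → ℝ} (hG : Continuous G) (hz : Continuous z)
    (hGp : eLpNorm G (ENNReal.ofReal p) (torusMeasure d) ≤ 1) :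
    ∫⁻ x, ‖G x‖ₑ ^ 2 * ‖z x‖ₑ ^ 2 ∂(torusMeasure d) ≤
      (eLpNorm z (ENNReal.ofReal s) (torusMeasure d) ^ 2) ^ (1 - b / 2) *
        (∫⁻ x, ‖z x‖ₑ ∂(torusMeasure d)) ^ b := by
  have hp0 : 0 < p := by linarith
  have hs0 : 0 < s := by linarith
  have hsp : (∫⁻ x, ‖z x‖ₑ ^ s ∂(torusMeasure d)) ^ a =
      (eLpNorm z (ENNReal.ofReal s) (torusMeasure d) ^ 2) ^ (1 - b / 2) := by
    rw [eLpNorm_eq_lintegral_rpow_enorm_toReal (by simpa using hs0) ENNReal.ofReal_ne_top,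
      ENNReal.toReal_ofReal hs0.le, ← ENNReal.rpow_natCast, ← ENNReal.rpow_mul, ← ENNReal.rpow_mul]
    congr 1
    field_simp
    push_cast
    linarith
  have hGle : (∫⁻ x, ‖G x‖ₑ ^ p ∂(torusMeasure d)) ^ (2 / p) ≤ 1 := by
    rw [eLpNorm_eq_lintegral_rpow_enorm_toReal (by simpa using hp0) ENNReal.ofReal_ne_top,
      ENNReal.toReal_ofReal hp0.le] at hGp
    have := ENNReal.rpow_le_rpow hGp (z := 2) (by norm_num)
    rw [← ENNReal.rpow_mul, ENNReal.one_rpow] at this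
    convert this using 2
    ring
  have hmain := ENNReal.lintegral_prod_norm_pow_le (μ := torusMeasure d) Finset.univ
    (f := ![fun x => ‖G x‖ₑ ^ p, fun x => ‖z x‖ₑ ^ s, fun x => ‖z x‖ₑ]) (p := ![2 / p, a, b])
    (by
      intro i _
      fin_cases i
      · exact (by fun_prop : Measurable fun x => ‖G x‖ₑ ^ p).aemeasurable
      · exact (by fun_prop : Measurable fun x => ‖z x‖ₑ ^ s).aemeasurable
      · exact (by fun_prop : Measurable fun x => ‖z x‖ₑ).aemeasurable)
    (by simpa [Fin.sum_univ_three] using hab)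
    (by
      intro i _
      fin_cases i
      · simpa using by positivity
      · simpa using ha
      · simpa using hb)
  simp only [Fin.prod_univ_three, Matrix.cons_val] at hmain
  calc ∫⁻ x, ‖G x‖ₑ ^ 2 * ‖z x‖ₑ ^ 2 ∂(torusMeasure d)
      = ∫⁻ x, (‖G x‖ₑ ^ p) ^ (2 / p) * (‖z x‖ₑ ^ s) ^ a * ‖z x‖ₑ ^ b ∂(torusMeasure d) := by
        refine lintegral_congr fun x => ?_
        rw [← ENNReal.rpow_mul, ← ENNReal.rpow_mul, mul_assoc,
          ← ENNReal.rpow_add_of_nonneg _ _ (by positivity) hb, hsab,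
          mul_div_cancel₀ _ hp0.ne']
        norm_cast
    _ ≤ _ := hmain
    _ ≤ 1 * (∫⁻ x, ‖z x‖ₑ ^ s ∂(torusMeasure d)) ^ a * (∫⁻ x, ‖z x‖ₑ ∂(torusMeasure d)) ^ b := by
        gcongr
    _ = _ := by rw [one_mul, hsp]

/-- Weighted Young with weights `1 - β` and `β`, the constants being arranged so that the left side
is exactly `(δE)^{1-β} R^β`. The power of `A` is explicit because the iteration needs polynomial
growth in `q`. -/
lemma young_interpolation {β δ K A : ℝ} (hβ : 0 < β) (hβ1 : β < 1) (hδ : 0 < δ) (hK : 0 ≤ K)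
    (hA : 0 ≤ A) {E Y : ℝ} (hE : 0 ≤ E) (hY : 0 ≤ Y) :
    A * ((K * E) ^ (1 - β) * Y ^ β) ≤ δ * E + ((K / δ) ^ (1 - β)) ^ (1 / β) * A ^ (1 / β) * Y := by
  have hKδ : 0 ≤ K / δ := by positivity
  set R : ℝ := ((K / δ) ^ (1 - β)) ^ (1 / β) * A ^ (1 / β) * Y with hR
  have hR0 : 0 ≤ R := by positivity
  have h1 : A * ((K * E) ^ (1 - β) * Y ^ β) = (δ * E) ^ (1 - β) * R ^ β := by
    have h3 : K * E = (K / δ) * (δ * E) := by field_simp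
    have h4 : R ^ β = (K / δ) ^ (1 - β) * A * Y ^ β := by
      rw [hR, Real.mul_rpow (by positivity) hY, Real.mul_rpow (by positivity) (by positivity),
        ← Real.rpow_mul (by positivity) (1 / β) β, ← Real.rpow_mul hA, one_div_mul_cancel hβ.ne',
        Real.rpow_one, Real.rpow_one]
    rw [h3, h4, Real.mul_rpow hKδ (by positivity)]
    ring
  rw [h1]
  have := Real.geom_mean_le_arith_mean2_weighted (w₁ := 1 - β) (w₂ := β) (by linarith) hβ.le
    (by positivity : 0 ≤ δ * E) hR0 (by ring)
  have h2 : 0 ≤ δ * E := by positivity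
  nlinarith

/-- Interpolation between the energy and the `L¹` norm, with an `L^p` potential, `p > d`. -/
lemma torus_interpolation {d : ℕ} (hd : 2 ≤ d) {p : ℝ} (hp : (d : ℝ) < p) :
    ∃ N : ℝ, 0 ≤ N ∧ ∀ δ : ℝ, 0 < δ → ∃ C : ℝ, 0 ≤ C ∧ ∀ A : ℝ, 0 ≤ A → ∀ G z : Space d → ℝ,
      Continuous G → ContDiff ℝ 1 z → TorusPeriodic z →
      eLpNorm G (ENNReal.ofReal p) (torusMeasure d) ≤ 1 →
      A * ∫ x, G x ^ 2 * z x ^ 2 ∂(torusMeasure d) ≤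
        δ * (∫ x, ‖fderiv ℝ z x‖ ^ 2 ∂(torusMeasure d) + ∫ x, z x ^ 2 ∂(torusMeasure d)) +
          C * A ^ N * (∫ x, |z x| ∂(torusMeasure d)) ^ 2 := by
  have hd0 : (2 : ℝ) ≤ d := by exact_mod_cast hd
  have hp2 : 2 < p := by linarith
  have hp0 : 0 < p := by linarith
  have hpd : 1 / p < 1 / (d : ℝ) := one_div_lt_one_div_of_lt (by linarith) hp
  have hd2 : 1 / (d : ℝ) ≤ 1 / 2 := one_div_le_one_div_of_le (by norm_num) hd0
  have hpi : 0 < 1 / p := by positivity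
  -- Midpoint of `1/2 - 1/d` and `1/2 - 1/p`, an interval that is nonempty because `p > d`. Lying
  -- above the first makes `s = 1/σ` subcritical for Sobolev; lying below the second makes `b > 0`.
  set σ : ℝ := 1 / 2 - (1 / p + 1 / d) / 2 with hσ
  have hσ0 : 0 < σ := by rw [hσ]; linarith
  have hσ2 : σ < 1 / 2 - 1 / p := by rw [hσ]; linarith
  set s : ℝ := 1 / σ with hs
  have hsσ : 1 / s = σ := by rw [hs, one_div_one_div]
  have hs2 : 2 ≤ s := by rw [hs, le_div_iff₀ hσ0]; linarith
  have hs1 : 0 < s - 1 := by linarith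
  obtain ⟨K, hK⟩ := torus_sobolev hd hs2 (by rw [hsσ, hσ]; linarith)
  have h2p : 2 / p = 2 * (1 / p) := by ring
  -- `a` and `b` solve `2/p + a + b = 1` and `s a + b = 2`.
  set a : ℝ := (1 + 2 / p) / (s - 1) with ha
  have ha0 : 0 ≤ a := by positivity
  have has : a * (s - 1) = 1 + 2 / p := by rw [ha]; field_simp
  set b : ℝ := 1 - 2 / p - a with hb
  have hb0 : 0 < b := by
    have : 1 < s * (1 / 2 - 1 / p) := by
      calc 1 = s * σ := by rw [hs]; field_simp
        _ < _ := by gcongr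
    have h3 : a < 1 - 2 / p := by
      rw [ha, div_lt_iff₀ hs1]
      nlinarith
    rw [hb]; linarith
  have hb1 : b < 2 := by
    have : 0 < 2 / p := by positivity
    rw [hb]; linarith
  refine ⟨1 / (b / 2), by positivity, fun δ hδ => ?_⟩
  refine ⟨(((K : ℝ) / δ) ^ (1 - b / 2)) ^ (1 / (b / 2)), by positivity,
    fun A hA G z hG hz hzp hGp => ?_⟩
  have hzd : Continuous (fderiv ℝ z) := hz.continuous_fderiv (by norm_num)
  have hzc := hz.continuous
  set E : ℝ := ∫ x, ‖fderiv ℝ z x‖ ^ 2 ∂(torusMeasure d) + ∫ x, z x ^ 2 ∂(torusMeasure d) with hE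
  have hE0 : 0 ≤ E := add_nonneg (integral_nonneg fun x => by positivity)
    (integral_nonneg fun x => by positivity)
  set Y : ℝ := ∫ x, |z x| ∂(torusMeasure d) with hY
  have hY0 : 0 ≤ Y := integral_nonneg fun x => by positivity
  have hEe : torusEnergy z = ENNReal.ofReal E := by
    rw [hE, ENNReal.ofReal_add (integral_nonneg fun x => by positivity)
      (integral_nonneg fun x => by positivity),
      ofReal_integral_eq_lintegral_ofReal (Continuous.integrable_torus (by fun_prop))
        (Eventually.of_forall fun x => by positivity),
      ofReal_integral_eq_lintegral_ofReal (Continuous.integrable_torus (by fun_prop))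
        (Eventually.of_forall fun x => by positivity)]
    rw [torusEnergy]
    congr 1
    · refine lintegral_congr fun x => ?_
      rw [ENNReal.ofReal_pow (norm_nonneg _), ofReal_norm]
    · refine lintegral_congr fun x => ?_
      rw [← sq_abs, ENNReal.ofReal_pow (abs_nonneg _), ← Real.enorm_eq_ofReal_abs]
  have hYe : ∫⁻ x, ‖z x‖ₑ ∂(torusMeasure d) = ENNReal.ofReal Y := by
    rw [hY, ofReal_integral_eq_lintegral_ofReal (Continuous.integrable_torus (by fun_prop))
        (Eventually.of_forall fun x => by positivity)]
    simp [← Real.enorm_eq_ofReal_abs]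
  have hIe : ∫⁻ x, ‖G x‖ₑ ^ 2 * ‖z x‖ₑ ^ 2 ∂(torusMeasure d) =
      ENNReal.ofReal (∫ x, G x ^ 2 * z x ^ 2 ∂(torusMeasure d)) := by
    rw [ofReal_integral_eq_lintegral_ofReal (Continuous.integrable_torus (by fun_prop))
        (Eventually.of_forall fun x => by positivity)]
    refine lintegral_congr fun x => ?_
    rw [ENNReal.ofReal_mul (by positivity), ← sq_abs (G x), ← sq_abs (z x),
      ENNReal.ofReal_pow (abs_nonneg _), ENNReal.ofReal_pow (abs_nonneg _),
      ← Real.enorm_eq_ofReal_abs, ← Real.enorm_eq_ofReal_abs]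
  have h1 := torus_hoelder_interpolation hp2 (by linarith : 1 < s) ha0 hb0.le
    (by rw [hb]; ring) (by rw [hb]; linarith) hG hzc hGp
  rw [hIe, hYe] at h1
  have h2 : ENNReal.ofReal (∫ x, G x ^ 2 * z x ^ 2 ∂(torusMeasure d)) ≤
      ENNReal.ofReal ((K * E) ^ (1 - b / 2) * (Y ^ 2) ^ (b / 2)) := by
    refine h1.trans ?_
    rw [ENNReal.ofReal_mul (by positivity), ← ENNReal.ofReal_rpow_of_nonneg (by positivity)
      (by linarith), ← ENNReal.ofReal_rpow_of_nonneg (by positivity) (by positivity),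
      ENNReal.ofReal_mul (by positivity), ← hEe, ENNReal.ofReal_coe_nnreal,
      ENNReal.ofReal_pow hY0, ← ENNReal.rpow_natCast (ENNReal.ofReal Y), ← ENNReal.rpow_mul]
    refine mul_le_mul' (ENNReal.rpow_le_rpow (hK z hz hzp) (by linarith)) (le_of_eq ?_)
    congr 1
    push_cast
    ring
  rw [ENNReal.ofReal_le_ofReal_iff (by positivity)] at h2
  exact (mul_le_mul_of_nonneg_left h2 hA).trans
    (young_interpolation (by positivity) (by linarith) hδ K.2 hA hE0 (by positivity))

/-! ### Energy estimate for exponentials -/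

lemma norm_gradient_eq {d : ℕ} (f : Space d → ℝ) (x : Space d) : ‖∇ f x‖ = ‖fderiv ℝ f x‖ := by
  rw [← toDual_gradient, LinearIsometryEquiv.norm_map]

lemma norm_fderiv_sq {d : ℕ} (f : Space d → ℝ) (x : Space d) :
    ‖fderiv ℝ f x‖ ^ 2 = ∑ i, partialDeriv i f x ^ 2 := by
  rw [(EuclideanSpace.basisFun (Fin d) ℝ).norm_dual]
  simp [partialDeriv]

lemma laplacian_eq_sum_partialDeriv {d : ℕ} {f : Space d → ℝ} (hf : ContDiff ℝ 2 f) (x : Space d) :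
    Δ f x = ∑ i, partialDeriv i (partialDeriv i f) x := by
  rw [InnerProductSpace.laplacian_eq_iteratedFDeriv_orthonormalBasis f
    (EuclideanSpace.basisFun (Fin d) ℝ)]
  refine Finset.sum_congr rfl fun i _ => ?_
  have h : DifferentiableAt ℝ (fderiv ℝ f) x :=
    (hf.fderiv_right (m := 1) (by norm_num)).differentiable (by norm_num) x
  rw [iteratedFDeriv_two_apply]
  simp only [partialDeriv, Matrix.cons_val_zero, Matrix.cons_val_one, EuclideanSpace.basisFun_apply]
  have := (h.hasFDerivAt.clm_apply (hasFDerivAt_const (EuclideanSpace.single i (1 : ℝ)) x)).fderiv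
  change _ = fderiv ℝ (fun y => fderiv ℝ f y (EuclideanSpace.single i 1)) x _
  rw [this]
  simp

lemma ContDiff.partialDeriv {d : ℕ} {f : Space d → ℝ} (hf : ContDiff ℝ 2 f) (i : Fin d) :
    ContDiff ℝ 1 (partialDeriv i f) :=
  (hf.fderiv_right (m := 1) (by norm_num)).clm_apply contDiff_const

lemma TorusPeriodic.partialDeriv {d : ℕ} {f : Space d → ℝ} (hf : TorusPeriodic f) (i : Fin d) :
    TorusPeriodic (partialDeriv i f) := by
  intro j x
  rw [_root_.partialDeriv, hf.fderiv j x, _root_.partialDeriv]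

lemma fderiv_exp_mul {d : ℕ} {f h : Space d → ℝ} (q : ℝ) {x : Space d}
    (hf : DifferentiableAt ℝ f x) (hh : DifferentiableAt ℝ h x) (ξ : Space d) :
    fderiv ℝ (fun y => Real.exp (q * f y) * h y) x ξ =
      Real.exp (q * f x) * (fderiv ℝ h x ξ + q * fderiv ℝ f x ξ * h x) := by
  have h1 := (((hf.hasFDerivAt.const_mul q).exp).mul hh.hasFDerivAt).fderiv
  have h2 : fderiv ℝ (fun y => Real.exp (q * f y) * h y) x = _ := h1
  rw [h2]
  simp
  ring

lemma continuous_laplacian {d : ℕ} {f : Space d → ℝ} (hf : ContDiff ℝ 2 f) :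
    Continuous (Δ f) := by
  rw [show Δ f = fun x => ∑ i, _root_.partialDeriv i (_root_.partialDeriv i f) x from
    funext fun x => laplacian_eq_sum_partialDeriv hf x]
  refine continuous_finsetSum _ fun i _ => ?_
  exact ((hf.partialDeriv i).continuous_fderiv (by norm_num)).clm_apply continuous_const

lemma integral_exp_mul_fderiv {d : ℕ} {f h : Space d → ℝ} (hf : ContDiff ℝ 1 f)
    (hfp : TorusPeriodic f) (hh : ContDiff ℝ 1 h) (hhp : TorusPeriodic h) (q : ℝ) (ξ : Space d) :
    ∫ x, Real.exp (q * f x) * fderiv ℝ h x ξ ∂(torusMeasure d) =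
      -∫ x, Real.exp (q * f x) * (q * fderiv ℝ f x ξ * h x) ∂(torusMeasure d) := by
  have hfc := hf.continuous
  have hhc := hh.continuous
  have hf' : Continuous fun x => fderiv ℝ f x ξ :=
    (hf.continuous_fderiv (by norm_num)).clm_apply continuous_const
  have hh' : Continuous fun x => fderiv ℝ h x ξ :=
    (hh.continuous_fderiv (by norm_num)).clm_apply continuous_const
  have h0 : ∫ x, fderiv ℝ (fun y => Real.exp (q * f y) * h y) x ξ ∂(torusMeasure d) = 0 := by
    refine TorusPeriodic.integral_fderiv (fun i x => ?_) (by fun_prop) ξ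
    simp only [hfp i x, hhp i x]
  simp_rw [fderiv_exp_mul q (hf.differentiable (by norm_num) _)
    (hh.differentiable (by norm_num) _), mul_add] at h0
  rw [integral_add (Continuous.integrable_torus (by fun_prop))
    (Continuous.integrable_torus (by fun_prop))] at h0
  linarith

lemma integral_exp_mul_laplacian {d : ℕ} {f : Space d → ℝ} (hf : ContDiff ℝ 2 f)
    (hfp : TorusPeriodic f) (q : ℝ) :
    ∫ x, Real.exp (q * f x) * Δ f x ∂(torusMeasure d) =
      -q * ∫ x, Real.exp (q * f x) * ‖fderiv ℝ f x‖ ^ 2 ∂(torusMeasure d) := by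
  have hf1 : ContDiff ℝ 1 f := hf.of_le (by norm_num)
  have hfc := hf.continuous
  have hpc : ∀ i, Continuous (_root_.partialDeriv i f) := fun i => (hf.partialDeriv i).continuous
  have hppc : ∀ i, Continuous (_root_.partialDeriv i (_root_.partialDeriv i f)) := fun i =>
    ((hf.partialDeriv i).continuous_fderiv (by norm_num)).clm_apply continuous_const
  simp_rw [laplacian_eq_sum_partialDeriv hf, norm_fderiv_sq, Finset.mul_sum]
  rw [integral_finsetSum _ fun i _ => Continuous.integrable_torus (by have := hppc i; fun_prop),
    integral_finsetSum _ fun i _ => Continuous.integrable_torus (by have := hpc i; fun_prop),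
    Finset.mul_sum]
  refine Finset.sum_congr rfl fun i _ => ?_
  have := integral_exp_mul_fderiv hf1 hfp (hf.partialDeriv i) (hfp.partialDeriv i) q
    (EuclideanSpace.single i 1)
  rw [← integral_const_mul]
  simp only [← integral_neg] at this
  refine this.trans (integral_congr_ae (Eventually.of_forall fun x => ?_))
  simp only [_root_.partialDeriv]
  ring

/-- Testing `r - Δw ≤ ¼|Dw|² + ∂_ξ G` with `e^{qw}`. -/
lemma exp_energy_estimate {d : ℕ} {w G r : Space d → ℝ} (hw : ContDiff ℝ 2 w)
    (hwp : TorusPeriodic w) (hG : ContDiff ℝ 1 G) (hGp : TorusPeriodic G) (hr : Continuous r)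
    {ξ : Space d} (hξ : ‖ξ‖ ≤ 1) {q : ℝ} (hq : 1 ≤ q)
    (hineq : ∀ x, r x - Δ w x ≤ 1 / 4 * ‖fderiv ℝ w x‖ ^ 2 + fderiv ℝ G x ξ) :
    ∫ x, q * Real.exp (q * w x) * r x ∂(torusMeasure d) ≤
      -2 * ∫ x, ‖fderiv ℝ (fun y => Real.exp (q / 2 * w y)) x‖ ^ 2 ∂(torusMeasure d) +
        q ^ 2 * ∫ x, G x ^ 2 * Real.exp (q / 2 * w x) ^ 2 ∂(torusMeasure d) := by
  have hw1 : ContDiff ℝ 1 w := hw.of_le (by norm_num)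
  have hwc := hw.continuous
  have hGc := hG.continuous
  have hw' : Continuous (fderiv ℝ w) := hw1.continuous_fderiv (by norm_num)
  have hG' : Continuous (fderiv ℝ G) := hG.continuous_fderiv (by norm_num)
  have hΔ := continuous_laplacian hw
  -- The natural unknown is `z = e^{qw/2}`: both the energy density and `e^{qw}` are quadratic in
  -- it.
  have hz : ∀ x, ‖fderiv ℝ (fun y => Real.exp (q / 2 * w y)) x‖ ^ 2 =
      q ^ 2 / 4 * (Real.exp (q * w x) * ‖fderiv ℝ w x‖ ^ 2) := by
    intro x
    have h1 : fderiv ℝ (fun y => Real.exp (q / 2 * w y)) x = _ :=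
      (((hw1.differentiable (by norm_num) x).hasFDerivAt.const_mul (q / 2)).exp).fderiv
    rw [h1, norm_smul, norm_smul, mul_pow, mul_pow, Real.norm_eq_abs, Real.norm_eq_abs, sq_abs,
      sq_abs, ← Real.exp_nat_mul]
    rw [show ((2 : ℕ) : ℝ) * (q / 2 * w x) = q * w x by push_cast; ring]
    ring
  have he : ∀ x, Real.exp (q / 2 * w x) ^ 2 = Real.exp (q * w x) := by
    intro x
    rw [← Real.exp_nat_mul]
    congr 1
    push_cast
    ring
  simp_rw [hz, he]
  have hL := integral_exp_mul_laplacian hw hwp q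
  have hF := integral_exp_mul_fderiv hw1 hwp hG hGp q ξ
  set D := ∫ x, Real.exp (q * w x) * ‖fderiv ℝ w x‖ ^ 2 ∂(torusMeasure d) with hD
  set J := ∫ x, G x ^ 2 * Real.exp (q * w x) ∂(torusMeasure d) with hJ
  -- The derivative is moved off `G` onto the exponential, so only the size of `G` enters; Young
  -- leaves a quarter of the dissipation.
  have hF2 : ∫ x, Real.exp (q * w x) * fderiv ℝ G x ξ ∂(torusMeasure d) ≤ q * (1 / 4 * D + J) := by
    rw [hF, ← integral_neg, hD, hJ, ← integral_const_mul,
      ← integral_add (Continuous.integrable_torus (by fun_prop))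
      (Continuous.integrable_torus (by fun_prop)), ← integral_const_mul]
    refine integral_mono (Continuous.integrable_torus (by fun_prop))
      (Continuous.integrable_torus (by fun_prop)) fun x => ?_
    have h1 : |fderiv ℝ w x ξ| ≤ ‖fderiv ℝ w x‖ :=
      ((fderiv ℝ w x).le_opNorm ξ).trans (mul_le_of_le_one_right (norm_nonneg _) hξ)
    have h2 : -(fderiv ℝ w x ξ * G x) ≤ 1 / 4 * ‖fderiv ℝ w x‖ ^ 2 + G x ^ 2 := by
      nlinarith [sq_nonneg (fderiv ℝ w x ξ / 2 + G x), sq_abs (fderiv ℝ w x ξ),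
        abs_nonneg (fderiv ℝ w x ξ)]
    have h3 : 0 ≤ q * Real.exp (q * w x) := by positivity
    have h4 := mul_le_mul_of_nonneg_left h2 h3
    calc _ = q * Real.exp (q * w x) * -(fderiv ℝ w x ξ * G x) := by ring
      _ ≤ _ := h4
      _ = _ := by ring
  have hmain : ∫ x, Real.exp (q * w x) * r x ∂(torusMeasure d) ≤
      -q * D + (1 / 4 * D + ∫ x, Real.exp (q * w x) * fderiv ℝ G x ξ ∂(torusMeasure d)) := by
    rw [← hL, hD, ← integral_const_mul,
      ← integral_add (Continuous.integrable_torus (by fun_prop))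
      (Continuous.integrable_torus (by fun_prop)),
      ← integral_add (Continuous.integrable_torus (by fun_prop))
      (Continuous.integrable_torus (by fun_prop))]
    refine integral_mono (Continuous.integrable_torus (by fun_prop))
      (Continuous.integrable_torus (by fun_prop)) fun x => ?_
    have h3 : 0 ≤ Real.exp (q * w x) := by positivity
    nlinarith [mul_le_mul_of_nonneg_left (hineq x) h3]
  have hD0 : 0 ≤ D := integral_nonneg fun x => by positivity
  have e1 : ∫ x, q * Real.exp (q * w x) * r x ∂(torusMeasure d) =
      q * ∫ x, Real.exp (q * w x) * r x ∂(torusMeasure d) := by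
    rw [← integral_const_mul]
    simp_rw [mul_assoc]
  rw [e1, integral_const_mul]
  have h5 := mul_le_mul_of_nonneg_left (hmain.trans (by gcongr : _ ≤ -q * D +
    (1 / 4 * D + q * (1 / 4 * D + J)))) (by linarith : 0 ≤ q)
  -- The coefficient of `D` is `-q² + q/4 + q²/4 ≤ -q²/2` since `q ≥ 1`, and `q² D / 2` is twice the
  -- energy of `e^{qw/2}`.
  nlinarith [mul_nonneg (mul_nonneg (by linarith : 0 ≤ q) (by linarith : 0 ≤ q - 1)) hD0]

/-! ### Boundedness of subsolutions with natural growth, by Moser iteration -/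

/-- Periodic subsolutions of the backward inequality `-W_t - ΔW ≤ ¼|DW|² + ∂_ξ G` on `(0,T)` with
`W(T) ≤ 0` and `‖G(t)‖_p ≤ 1`. -/
structure IsBackwardSubsolution {d : ℕ} (T p : ℝ) (ξ : Space d) (W Wt G : ℝ → Space d → ℝ) :
    Prop where
  periodic : ∀ t ∈ Ioo 0 T, TorusPeriodic (W t)
  contDiff : ∀ t ∈ Ioo 0 T, ContDiff ℝ 2 (W t)
  source_periodic : ∀ t ∈ Ioo 0 T, TorusPeriodic (G t)
  source_contDiff : ∀ t ∈ Ioo 0 T, ContDiff ℝ 1 (G t)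
  continuousOn : ContinuousOn (fun z : ℝ × Space d => W z.1 z.2) (Ioc 0 T ×ˢ univ)
  hasDerivAt : ∀ t ∈ Ioo 0 T, ∀ x, HasDerivAt (fun s => W s x) (Wt t x) t
  continuousOn_deriv : ContinuousOn (fun z : ℝ × Space d => Wt z.1 z.2) (Ioo 0 T ×ˢ univ)
  terminal : ∀ x, W T x ≤ 0
  inequality : ∀ t ∈ Ioo 0 T, ∀ x,
    -Wt t x - Δ (W t) x ≤ 1 / 4 * ‖fderiv ℝ (W t) x‖ ^ 2 + fderiv ℝ (G t) x ξ
  source_norm : ∀ t ∈ Ioo 0 T, eLpNorm (G t) (ENNReal.ofReal p) (torusMeasure d) ≤ 1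

/-- `e^{as}(y - R)` is nondecreasing in time. The sign of `a` is free: a positive rate starts the
iteration, and the rate `-1` makes `R` a barrier. -/
lemma backward_gronwall {y y' : ℝ → ℝ} {a R t T : ℝ} (htT : t ≤ T) (hc : ContinuousOn y (Icc t T))
    (hd : ∀ s ∈ Ioo t T, HasDerivAt y (y' s) s) (hineq : ∀ s ∈ Ioo t T, -y' s ≤ a * (y s - R)) :
    Real.exp (a * t) * (y t - R) ≤ Real.exp (a * T) * (y T - R) := by
  have hD : ∀ s ∈ Ioo t T, HasDerivAt (fun s => Real.exp (a * s) * (y s - R))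
      (Real.exp (a * s) * a * (y s - R) + Real.exp (a * s) * y' s) s := fun s hs => by
    have h1 : HasDerivAt (fun s => Real.exp (a * s)) (Real.exp (a * s) * a) s := by
      simpa using ((hasDerivAt_id s).const_mul a).exp
    exact h1.mul ((hd s hs).sub_const R)
  refine monotoneOn_of_deriv_nonneg (f := fun s => Real.exp (a * s) * (y s - R)) (convex_Icc t T)
    (by fun_prop) ?_ ?_ (left_mem_Icc.2 htT) (right_mem_Icc.2 htT) htT
  · rw [interior_Icc]
    exact fun s hs => (hD s hs).differentiableAt.differentiableWithinAt
  · rw [interior_Icc]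
    intro s hs
    rw [(hD s hs).deriv]
    have := hineq s hs
    have h2 := Real.exp_pos (a * s)
    nlinarith [mul_nonneg h2.le (by linarith : 0 ≤ y' s + a * (y s - R))]

/-- The variance of `z` under a probability measure is nonnegative. -/
lemma sq_torus_integral_le {d : ℕ} {z : Space d → ℝ} (hz : Continuous z) :
    (∫ x, z x ∂(torusMeasure d)) ^ 2 ≤ ∫ x, z x ^ 2 ∂(torusMeasure d) := by
  set Y := ∫ x, z x ∂(torusMeasure d)
  have h : 0 ≤ ∫ x, (z x ^ 2 - 2 * Y * z x + Y ^ 2) ∂(torusMeasure d) :=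
    integral_nonneg fun x => by
      simp only [Pi.zero_apply]
      nlinarith [sq_nonneg (z x - Y)]
  rw [integral_add (Continuous.integrable_torus (by fun_prop))
      (Continuous.integrable_torus (by fun_prop)),
    integral_sub (Continuous.integrable_torus (by fun_prop))
      (Continuous.integrable_torus (by fun_prop)), integral_const_mul] at h
  simp at h
  nlinarith

lemma IsBackwardSubsolution.section_continuous {d : ℕ} {T p : ℝ} {ξ : Space d}
    {W Wt G : ℝ → Space d → ℝ} (h : IsBackwardSubsolution T p ξ W Wt G) {t : ℝ}
    (ht : t ∈ Ioo 0 T) : Continuous (Wt t) := by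
  rw [← continuousOn_univ]
  exact h.continuousOn_deriv.comp (f := fun x => (t, x)) (by fun_prop) fun x _ => ⟨ht, mem_univ _⟩

lemma IsBackwardSubsolution.hasDerivAt_integral_exp {d : ℕ} {T p : ℝ} {ξ : Space d}
    {W Wt G : ℝ → Space d → ℝ} (h : IsBackwardSubsolution T p ξ W Wt G) (q : ℝ) {t : ℝ}
    (ht : t ∈ Ioo 0 T) :
    HasDerivAt (fun s => ∫ x, Real.exp (q * W s x) ∂(torusMeasure d))
      (∫ x, q * Real.exp (q * W t x) * Wt t x ∂(torusMeasure d)) t := by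
  have hW : ContinuousOn (fun z : ℝ × Space d => W z.1 z.2) (Ioo 0 T ×ˢ univ) :=
    h.continuousOn.mono (prod_mono Ioo_subset_Ioc_self subset_rfl)
  refine hasDerivAt_torus_integral (f := fun s x => Real.exp (q * W s x))
    (f' := fun s x => q * Real.exp (q * W s x) * Wt s x) isOpen_Ioo ht ?_ ?_ ?_
  · have := h.continuousOn_deriv
    fun_prop
  · intro τ hτ
    have := (h.contDiff τ hτ).continuous
    fun_prop
  · intro τ hτ x
    convert ((h.hasDerivAt τ hτ x).const_mul q).exp using 1
    ring

lemma IsBackwardSubsolution.continuousOn_integral_exp {d : ℕ} {T p : ℝ} {ξ : Space d}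
    {W Wt G : ℝ → Space d → ℝ} (h : IsBackwardSubsolution T p ξ W Wt G) (q : ℝ) :
    ContinuousOn (fun s => ∫ x, Real.exp (q * W s x) ∂(torusMeasure d)) (Ioc 0 T) := by
  refine continuousOn_torus_integral (f := fun s x => Real.exp (q * W s x)) ?_
  have := h.continuousOn
  fun_prop

lemma IsBackwardSubsolution.integral_exp_terminal_le {d : ℕ} {T p : ℝ} {ξ : Space d}
    {W Wt G : ℝ → Space d → ℝ} (h : IsBackwardSubsolution T p ξ W Wt G) (hT : 0 < T) {q : ℝ}
    (hq : 0 ≤ q) : ∫ x, Real.exp (q * W T x) ∂(torusMeasure d) ≤ 1 := by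
  have hc : Continuous (W T) := by
    rw [← continuousOn_univ]
    exact h.continuousOn.comp (f := fun x => (T, x)) (by fun_prop)
      fun x _ => ⟨right_mem_Ioc.2 hT, mem_univ _⟩
  calc _ ≤ ∫ _, (1 : ℝ) ∂(torusMeasure d) := by
        refine integral_mono (Continuous.integrable_torus (by fun_prop)) (integrable_const _)
          fun x => ?_
        exact Real.exp_le_one_iff.2 (mul_nonpos_of_nonneg_of_nonpos hq (h.terminal x))
    _ = 1 := by simp

/-- The differential inequality for `∫ e^{qW}` in terms of `∫ e^{qW/2}`. -/
lemma exists_integral_exp_deriv_le {d : ℕ} (hd : 2 ≤ d) {p : ℝ} (hp : (d : ℝ) < p) :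
    ∃ N C : ℝ, 0 ≤ N ∧ 1 ≤ C ∧ ∀ (T : ℝ) (ξ : Space d) (W Wt G : ℝ → Space d → ℝ), ‖ξ‖ ≤ 1 →
      IsBackwardSubsolution T p ξ W Wt G → ∀ t ∈ Ioo 0 T, ∀ q : ℝ, 1 ≤ q →
      -∫ x, q * Real.exp (q * W t x) * Wt t x ∂(torusMeasure d) +
        ∫ x, Real.exp (q * W t x) ∂(torusMeasure d) ≤
      C * q ^ N * (∫ x, Real.exp (q / 2 * W t x) ∂(torusMeasure d)) ^ 2 := by
  obtain ⟨N, hN, hint⟩ := torus_interpolation hd hp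
  obtain ⟨C, hC, hint⟩ := hint (1 / 2) (by norm_num)
  refine ⟨2 * N, max 1 (4 * C), by positivity, le_max_left _ _,
    fun T ξ W Wt G hξ h t ht q hq => ?_⟩
  have hw := h.contDiff t ht
  have hw1 : ContDiff ℝ 1 (W t) := hw.of_le (by norm_num)
  have hwp := h.periodic t ht
  have hwc := hw.continuous
  have hWtc := h.section_continuous ht
  have hE := exp_energy_estimate hw hwp (h.source_contDiff t ht) (h.source_periodic t ht)
    (hWtc.neg) hξ hq (h.inequality t ht)
  have hz : ContDiff ℝ 1 fun x => Real.exp (q / 2 * W t x) := by fun_prop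
  have hzp : TorusPeriodic fun x => Real.exp (q / 2 * W t x) := fun i x => by
    simp only [hwp i x]
  have hI1 := hint (q ^ 2) (by positivity) (G t) _ (h.source_contDiff t ht).continuous hz hzp
    (h.source_norm t ht)
  -- The same interpolation with potential 1 bounds `∫ z²` by the energy of `z` and `(∫ z)²`. It
  -- produces the damping term `+ y_q`, which prevents a Gronwall factor from accumulating at each
  -- step.
  have hI2 := hint 1 zero_le_one (fun _ => 1) _ continuous_const hz hzp (by
    rw [eLpNorm_const _ (by simpa using (by linarith [(Nat.cast_nonneg d : (0 : ℝ) ≤ d)] : 0 < p))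
      (NeZero.ne _)]
    simp)
  have he : ∀ x, Real.exp (q / 2 * W t x) ^ 2 = Real.exp (q * W t x) := by
    intro x
    rw [← Real.exp_nat_mul]
    congr 1
    push_cast
    ring
  simp only [he, one_pow, one_mul, Real.one_rpow, mul_one, abs_of_pos (Real.exp_pos _)] at hI1 hI2 hE
  simp only [Pi.neg_apply, mul_neg, integral_neg] at hE
  have hqN : (q ^ 2) ^ N = q ^ (2 * N) := by
    rw [← Real.rpow_natCast, ← Real.rpow_mul (by linarith)]
    norm_num
  rw [hqN] at hI1
  set Y2 := (∫ x, Real.exp (q / 2 * W t x) ∂(torusMeasure d)) ^ 2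
  have hY0 : 0 ≤ Y2 := by positivity
  have hq1 : 1 ≤ q ^ (2 * N) := Real.one_le_rpow hq (by positivity)
  have h1 : C * Y2 ≤ C * q ^ (2 * N) * Y2 := by
    rw [mul_right_comm]
    exact le_mul_of_one_le_right (by positivity) hq1
  -- Adding three times `hI2` to the estimate makes the gradient terms cancel (`-2 + 1/2 + 3/2 = 0`)
  -- and leaves `4C`.
  have h2 : 4 * C * (q ^ (2 * N) * Y2) ≤ max 1 (4 * C) * (q ^ (2 * N) * Y2) :=
    mul_le_mul_of_nonneg_right (le_max_right _ _) (by positivity)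
  linarith

/-- If `f` were positive somewhere, it would exceed a positive constant on a set of positive
measure, and Chebyshev would make the integrals unbounded in `k`. -/
lemma nonpos_of_integral_exp_le {d : ℕ} {f : Space d → ℝ} (hf : Continuous f)
    (hfp : TorusPeriodic f)
    (h : ∀ k : ℕ, ∫ x, Real.exp (2 ^ k * f x) ∂(torusMeasure d) ≤ 1) (x : Space d) : f x ≤ 0 := by
  by_contra! hx
  -- Translation moves `x` to the center of the cell, because the half-open cell is not a
  -- neighborhood of its boundary points.
  set v : Space d := x - cellCenter d
  have hc : Continuous fun y => f (v + y) := by fun_prop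
  have hnb : unitCell d ∩ {y | f x / 2 < f (v + y)} ∈ 𝓝 (cellCenter d) := by
    refine inter_mem (unitCell_mem_nhds d) (hc.continuousAt.eventually (lt_mem_nhds ?_))
    simp only [v, sub_add_cancel]
    linarith
  have hpos : 0 < (torusMeasure d).real {y | f x / 2 < f (v + y)} := by
    rw [measureReal_def, torusMeasure,
      Measure.restrict_apply (measurableSet_lt measurable_const hc.measurable), inter_comm]
    refine ENNReal.toReal_pos (Measure.measure_pos_of_mem_nhds _ hnb).ne' ?_
    refine ((measure_mono inter_subset_left).trans_lt ?_).ne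
    rw [volume_unitCell]
    exact ENNReal.one_lt_top
  set m := (torusMeasure d).real {y | f x / 2 < f (v + y)}
  have hk : ∀ k : ℕ, 2 ^ k * (f x / 2) * m ≤ 1 := by
    intro k
    have hc2 : Continuous fun y => Real.exp (2 ^ k * f (v + y)) := by fun_prop
    have hper : TorusPeriodic fun y => Real.exp (2 ^ k * f y) := fun i y => by simp only [hfp i y]
    have h1 := mul_meas_ge_le_integral_of_nonneg (μ := torusMeasure d)
      (f := fun y => Real.exp (2 ^ k * f (v + y))) (Eventually.of_forall fun y => by positivity)
      hc2.integrable_torus (Real.exp (2 ^ k * (f x / 2)))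
    rw [hper.integral_comp_add v] at h1
    have h2 : m ≤ (torusMeasure d).real
        {y | Real.exp (2 ^ k * (f x / 2)) ≤ Real.exp (2 ^ k * f (v + y))} := by
      refine measureReal_mono fun y hy => ?_
      have : f x / 2 < f (v + y) := hy
      exact Real.exp_le_exp.2 (by gcongr)
    calc 2 ^ k * (f x / 2) * m ≤ Real.exp (2 ^ k * (f x / 2)) * m := by
          refine mul_le_mul_of_nonneg_right ?_ hpos.le
          linarith [Real.add_one_le_exp (2 ^ k * (f x / 2))]
      _ ≤ _ := mul_le_mul_of_nonneg_left h2 (Real.exp_pos _).le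
      _ ≤ 1 := h1.trans (h k)
  have hcm : 0 < f x / 2 * m := by positivity
  obtain ⟨k, hk'⟩ := pow_unbounded_of_one_lt (1 / (f x / 2 * m)) (by norm_num : (1 : ℝ) < 2)
  rw [div_lt_iff₀ hcm] at hk'
  linarith [hk k]

/-- Induction on `q = 2^k`: squaring the bound for `q/2` doubles the exponent, and the subtracted
terms in the induction hypothesis absorb the factor `C q^N`. -/
lemma exists_backward_subsolution_le {d : ℕ} (hd : 2 ≤ d) {p : ℝ} (hp : (d : ℝ) < p) {T : ℝ}
    (hT : 0 < T) :
    ∃ β : ℝ, 0 ≤ β ∧ ∀ (ξ : Space d) (W Wt G : ℝ → Space d → ℝ), ‖ξ‖ ≤ 1 →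
      IsBackwardSubsolution T p ξ W Wt G → ∀ t ∈ Ioo 0 T, ∀ x, W t x ≤ β := by
  obtain ⟨N, C, hN, hC, hODE⟩ := exists_integral_exp_deriv_le hd hp
  -- `2^{kN} = e^{ck}`. The value of `a` makes `C 2^{(k+1)N}` times the square of the `k`-th bound
  -- equal to the next bound exactly, and `β` makes the bound for `k = 0` equal to `e^{CT}`.
  set c : ℝ := N * Real.log 2 with hc
  set a : ℝ := Real.log C + c with ha
  have hc0 : 0 ≤ c := mul_nonneg hN (Real.log_nonneg (by norm_num))
  have ha0 : 0 ≤ a := add_nonneg (Real.log_nonneg hC) hc0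
  have hC0 : 0 < C := by linarith
  set β : ℝ := C * T + a + c with hβ
  have hβ0 : 0 ≤ β := by positivity
  refine ⟨β, hβ0, fun ξ W Wt G hξ h => ?_⟩
  have key : ∀ k : ℕ, ∀ t ∈ Ioo 0 T, ∫ x, Real.exp (2 ^ k * W t x) ∂(torusMeasure d) ≤
      Real.exp (2 ^ k * β - (a + c) - c * k) := by
    intro k
    induction k with
    | zero =>
      intro t ht
      have hsub : Icc t T ⊆ Ioc 0 T := fun s hs => ⟨ht.1.trans_le hs.1, hs.2⟩
      have hsub' : Ioo t T ⊆ Ioo 0 T := fun s hs => ⟨ht.1.trans hs.1, hs.2⟩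
      -- For `q = 1`, Jensen gives `y_{1/2}² ≤ y_1`, so the inequality is linear in `y_1`.
      have hg := backward_gronwall (a := C) (R := 0) ht.2.le
        ((h.continuousOn_integral_exp 1).mono hsub)
        (fun s hs => h.hasDerivAt_integral_exp 1 (hsub' hs)) (fun s hs => by
          have h1 := hODE T ξ W Wt G hξ h s (hsub' hs) 1 le_rfl
          have hwc := (h.contDiff s (hsub' hs)).continuous
          have h2 := sq_torus_integral_le (z := fun x => Real.exp (1 / 2 * W s x)) (by fun_prop)
          have he : ∀ x, Real.exp (1 / 2 * W s x) ^ 2 = Real.exp (1 * W s x) := by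
            intro x
            rw [← Real.exp_nat_mul]
            congr 1
            push_cast
            ring
          simp only [he] at h2
          rw [Real.one_rpow, mul_one] at h1
          have h3 : 0 ≤ ∫ x, Real.exp (1 * W s x) ∂(torusMeasure d) :=
            integral_nonneg fun x => (Real.exp_pos _).le
          have h4 := mul_le_mul_of_nonneg_left h2 hC0.le
          rw [sub_zero]
          linarith)
      have hterm := h.integral_exp_terminal_le hT zero_le_one
      have hnn : 0 ≤ ∫ x, Real.exp (1 * W t x) ∂(torusMeasure d) :=
        integral_nonneg fun x => (Real.exp_pos _).le
      have h1 : 1 ≤ Real.exp (C * t) := Real.one_le_exp (mul_nonneg hC0.le ht.1.le)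
      have h2 := Real.exp_pos (C * T)
      have h3 : (2 : ℝ) ^ 0 * β - (a + c) - c * (0 : ℕ) = C * T := by
        rw [hβ]; push_cast; ring
      rw [h3, pow_zero]
      nlinarith
    | succ k ih =>
      intro t ht
      have hsub : Icc t T ⊆ Ioc 0 T := fun s hs => ⟨ht.1.trans_le hs.1, hs.2⟩
      have hsub' : Ioo t T ⊆ Ioo 0 T := fun s hs => ⟨ht.1.trans hs.1, hs.2⟩
      set R : ℝ := Real.exp (2 ^ (k + 1) * β - (a + c) - c * (k + 1 : ℕ)) with hR
      have h2k : ((k + 1 : ℕ) : ℝ) + 1 ≤ 2 ^ (k + 1) := by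
        exact_mod_cast Nat.lt_two_pow_self (n := k + 1)
      -- The barrier must dominate the terminal value, which is at most 1; `2^{k+1} ≥ k + 2` beats
      -- the subtracted linear terms.
      have hR1 : 1 ≤ R := by
        refine Real.one_le_exp ?_
        have h1 : a + c ≤ β := by rw [hβ]; nlinarith
        have h2 : ((k + 1 : ℕ) + 1 : ℝ) * (a + c) ≤ 2 ^ (k + 1) * β :=
          mul_le_mul h2k h1 (by positivity) (by positivity)
        have h3 : 0 ≤ ((k + 1 : ℕ) : ℝ) * a := by positivity
        linarith
      have hg := backward_gronwall (a := -1) (R := R) ht.2.le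
        ((h.continuousOn_integral_exp (2 ^ (k + 1))).mono hsub)
        (fun s hs => h.hasDerivAt_integral_exp (2 ^ (k + 1)) (hsub' hs)) (fun s hs => by
          have h1 := hODE T ξ W Wt G hξ h s (hsub' hs) (2 ^ (k + 1))
            (one_le_pow₀ (by norm_num))
          have hk2 : (2 : ℝ) ^ (k + 1) / 2 = 2 ^ k := by rw [pow_succ]; ring
          rw [hk2] at h1
          have hih := ih s (hsub' hs)
          have hnn : 0 ≤ ∫ x, Real.exp (2 ^ k * W s x) ∂(torusMeasure d) :=
            integral_nonneg fun x => (Real.exp_pos _).le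
          have h2 : C * ((2 : ℝ) ^ (k + 1)) ^ N *
              (∫ x, Real.exp (2 ^ k * W s x) ∂(torusMeasure d)) ^ 2 ≤ R := by
            have h3 : ((2 : ℝ) ^ (k + 1)) ^ N = Real.exp (c * (k + 1)) := by
              rw [hc, Real.rpow_def_of_pos (by positivity), Real.log_pow]
              congr 1
              push_cast
              ring
            calc _ ≤ Real.exp (Real.log C) * Real.exp (c * (k + 1)) *
                  Real.exp (2 ^ k * β - (a + c) - c * k) ^ 2 := by
                  rw [h3, Real.exp_log hC0]
                  gcongr
              _ = R := by
                  rw [← Real.exp_nat_mul, ← Real.exp_add, ← Real.exp_add, hR, ha]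
                  congr 1
                  push_cast
                  ring
          linarith)
      have hterm := h.integral_exp_terminal_le hT (q := 2 ^ (k + 1)) (by positivity)
      have h1 := Real.exp_pos (-1 * t)
      have h2 := Real.exp_pos (-1 * T)
      have h3 : Real.exp (-1 * T) * (∫ x, Real.exp (2 ^ (k + 1) * W T x) ∂(torusMeasure d) - R) ≤ 0 :=
        mul_nonpos_of_nonneg_of_nonpos h2.le (by linarith)
      by_contra! hcon
      linarith [mul_pos h1 (sub_pos.2 hcon)]
  intro t ht x
  have hwc := (h.contDiff t ht).continuous
  have := nonpos_of_integral_exp_le (f := fun x => W t x - β) (by fun_prop)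
    (fun i y => by simp only [h.periodic t ht i y]) (fun k => by
      have e : ∀ y, Real.exp (2 ^ k * (W t y - β)) =
          Real.exp (-(2 ^ k * β)) * Real.exp (2 ^ k * W t y) := fun y => by
        rw [← Real.exp_add]
        congr 1
        ring
      simp_rw [e]
      rw [integral_const_mul]
      calc _ ≤ Real.exp (-(2 ^ k * β)) * Real.exp (2 ^ k * β - (a + c) - c * k) :=
            mul_le_mul_of_nonneg_left (key k t ht) (Real.exp_pos _).le
        _ ≤ 1 := by
            rw [← Real.exp_add]
            refine Real.exp_le_one_iff.2 ?_
            have : 0 ≤ c * k := by positivity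
            linarith) x
  linarith

/-! ### Commutation of derivatives -/

lemma fderiv_fderiv_apply {E : Type*} [NormedAddCommGroup E] [NormedSpace ℝ E] {f : E → ℝ} {x : E}
    (hf : ContDiffAt ℝ 2 f x) (a b : E) :
    fderiv ℝ (fun y => fderiv ℝ f y a) x b = fderiv ℝ (fderiv ℝ f) x b a := by
  have h : DifferentiableAt ℝ (fderiv ℝ f) x :=
    (hf.fderiv_right (m := 1) (by norm_num)).differentiableAt (by norm_num)
  have := (h.hasFDerivAt.clm_apply (hasFDerivAt_const a x)).fderiv
  rw [this]
  simp

lemma fderiv_fderiv_comm {E : Type*} [NormedAddCommGroup E] [NormedSpace ℝ E] {f : E → ℝ} {x : E}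
    (hf : ContDiffAt ℝ 2 f x) (a b : E) :
    fderiv ℝ (fun y => fderiv ℝ f y a) x b = fderiv ℝ (fun y => fderiv ℝ f y b) x a := by
  rw [fderiv_fderiv_apply hf, fderiv_fderiv_apply hf]
  exact (hf.isSymmSndFDerivAt (by simp)).eq b a

lemma contDiff_fderiv_apply {d : ℕ} {n m : ℕ∞ω} {f : Space d → ℝ} (hf : ContDiff ℝ n f)
    (hmn : m + 1 ≤ n) (ξ : Space d) : ContDiff ℝ m (fun y => fderiv ℝ f y ξ) :=
  (hf.fderiv_right hmn).clm_apply contDiff_const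

lemma fderiv_laplacian {d : ℕ} {f : Space d → ℝ} (hf : ContDiff ℝ 3 f) (x ξ : Space d) :
    fderiv ℝ (Δ f) x ξ = Δ (fun y => fderiv ℝ f y ξ) x := by
  have hf2 : ContDiff ℝ 2 f := hf.of_le (by norm_num)
  have hi : ∀ a : Space d, ContDiff ℝ 2 (fun y => fderiv ℝ f y a) :=
    fun a => contDiff_fderiv_apply hf (by norm_num) a
  rw [laplacian_eq_sum_partialDeriv (hi ξ)]
  rw [show Δ f = fun x => ∑ i, _root_.partialDeriv i (_root_.partialDeriv i f) x from
    funext fun x => laplacian_eq_sum_partialDeriv hf2 x]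
  have hd : ∀ i : Fin d, DifferentiableAt ℝ (_root_.partialDeriv i (_root_.partialDeriv i f)) x :=
    fun i => (contDiff_fderiv_apply (hi (EuclideanSpace.single i 1)) (m := 1)
      (by norm_num) _).differentiable (by norm_num) x
  rw [fderiv_fun_sum fun i _ => hd i, sum_apply]
  refine Finset.sum_congr rfl fun i _ => ?_
  have h1 := fderiv_fderiv_comm (hi (EuclideanSpace.single i 1)).contDiffAt (x := x)
    (EuclideanSpace.single i 1) ξ
  refine h1.trans ?_
  have h2 : (fun y => fderiv ℝ (fun z => fderiv ℝ f z (EuclideanSpace.single i 1)) y ξ) =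
      _root_.partialDeriv i (fun y => fderiv ℝ f y ξ) :=
    funext fun y => fderiv_fderiv_comm hf2.contDiffAt _ _
  rw [h2, _root_.partialDeriv]

lemma contDiff_gradient {d : ℕ} {n m : ℕ∞ω} {f : Space d → ℝ} (hf : ContDiff ℝ n f)
    (hmn : m + 1 ≤ n) : ContDiff ℝ m (∇ f) :=
  (InnerProductSpace.toDual ℝ (Space d)).symm.contDiff.comp (hf.fderiv_right hmn)

/-- Derivative of `x ↦ H(x, Df(x))`. -/
lemma fderiv_hamiltonian_comp {d : ℕ} {H : Space d → Space d → ℝ}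
    (hH : ContDiff ℝ ∞ (fun z : Space d × Space d => H z.1 z.2)) {f : Space d → ℝ}
    (hf : ContDiff ℝ 2 f) (x ξ : Space d) :
    fderiv ℝ (fun y => H y (∇ f y)) x ξ = inner ℝ (gradX H x (∇ f x)) ξ +
      fderiv ℝ (fun y => fderiv ℝ f y ξ) x (gradP H x (∇ f x)) := by
  set p := ∇ f x with hp
  have hHd : ∀ z, DifferentiableAt ℝ (fun z : Space d × Space d => H z.1 z.2) z :=
    hH.differentiable (by simp)
  have hg : HasFDerivAt (∇ f) (fderiv ℝ (∇ f) x) x :=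
    ((contDiff_gradient hf (m := 1) (by norm_num)).differentiable (by norm_num) x).hasFDerivAt
  have h1 := ((hHd (x, p)).hasFDerivAt.comp x ((hasFDerivAt_id x).prodMk hg)).fderiv
  have h1' : fderiv ℝ (fun y => H y (∇ f y)) x = _ := h1
  have hx : fderiv ℝ (fun y => H y p) x ξ =
      fderiv ℝ (fun z : Space d × Space d => H z.1 z.2) (x, p) (ξ, 0) := by
    have h2 := ((hHd (x, p)).hasFDerivAt.comp x (f := fun y => (y, p))
      ((hasFDerivAt_id x).prodMk (hasFDerivAt_const p x))).fderiv
    have h2' : fderiv ℝ (fun y => H y p) x = _ := h2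
    rw [h2']
    simp
  have hpd : ∀ q, fderiv ℝ (fun r => H x r) p q =
      fderiv ℝ (fun z : Space d × Space d => H z.1 z.2) (x, p) (0, q) := by
    intro q
    have h2 := ((hHd (x, p)).hasFDerivAt.comp p (f := fun r => (x, r))
      ((hasFDerivAt_const x p).prodMk (hasFDerivAt_id p))).fderiv
    have h2' : fderiv ℝ (fun r => H x r) p = _ := h2
    rw [h2']
    simp
  have hq : fderiv ℝ (fun y => fderiv ℝ f y ξ) x (gradP H x p) =
      inner ℝ (gradP H x p) (fderiv ℝ (∇ f) x ξ) := by
    rw [fderiv_fderiv_comm hf.contDiffAt]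
    have h2 : (fun y => fderiv ℝ f y (gradP H x p)) = fun y => inner ℝ (gradP H x p) (∇ f y) :=
      funext fun y => by rw [real_inner_comm, inner_gradient_left]
    rw [h2]
    have h3 := ((hasFDerivAt_const (gradP H x p) x).inner ℝ hg).fderiv
    have h3' : fderiv ℝ (fun y => inner ℝ (gradP H x p) (∇ f y)) x = _ := h3
    rw [h3']
    simp
  rw [hq, gradX, inner_gradient_left, hx, gradP, inner_gradient_left, hpd, h1',
    ContinuousLinearMap.comp_apply, ← ContinuousLinearMap.map_add]
  simp

/-! ### Space-time sections -/

section Sections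

variable {d : ℕ} {F : ℝ × Space d → ℝ} {s : Set ℝ}

lemma ContDiffOn.section_contDiff (hF : ContDiffOn ℝ ∞ F (s ×ˢ univ)) {t : ℝ} (ht : t ∈ s) :
    ContDiff ℝ ∞ (fun x => F (t, x)) := by
  rw [← contDiffOn_univ]
  exact hF.comp (f := fun x => (t, x)) (by fun_prop) fun x _ => ⟨ht, mem_univ _⟩

/-- Spatial directions stay inside the slab, so this also holds at endpoint times; continuity of
`Du` up to `t = T` rests on it. -/
lemma ContDiffOn.section_fderiv (hF : ContDiffOn ℝ ∞ F (s ×ˢ univ)) {t : ℝ} (ht : t ∈ s)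
    (x ξ : Space d) :
    fderiv ℝ (fun y => F (t, y)) x ξ = fderivWithin ℝ F (s ×ˢ univ) (t, x) (0, ξ) := by
  have h1 : HasFDerivWithinAt F (fderivWithin ℝ F (s ×ˢ univ) (t, x)) (s ×ˢ univ) (t, x) :=
    (hF.differentiableOn (by simp) (t, x) ⟨ht, mem_univ _⟩).hasFDerivWithinAt
  have h2 := h1.comp x (s := univ)
    (((hasFDerivAt_const t x).prodMk (hasFDerivAt_id x)).hasFDerivWithinAt)
    fun y _ => ⟨ht, mem_univ _⟩
  have h3 : fderiv ℝ (fun y => F (t, y)) x = _ := (hasFDerivWithinAt_univ.1 h2).fderiv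
  rw [h3]
  simp

lemma ContDiffOn.continuousOn_section_fderiv (hs : UniqueDiffOn ℝ s)
    (hF : ContDiffOn ℝ ∞ F (s ×ˢ univ)) (ξ : Space d) :
    ContinuousOn (fun z : ℝ × Space d => fderiv ℝ (fun y => F (z.1, y)) z.2 ξ) (s ×ˢ univ) := by
  have h := (hF.continuousOn_fderivWithin (hs.prod uniqueDiffOn_univ) (by simp)).clm_apply
    (continuousOn_const (c := ((0 : ℝ), ξ)))
  refine h.congr fun z hz => hF.section_fderiv hz.1 z.2 ξ

lemma ContDiffOn.contDiffOn_fderiv_apply (hs : IsOpen s) (hF : ContDiffOn ℝ ∞ F (s ×ˢ univ))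
    (a : ℝ × Space d) : ContDiffOn ℝ ∞ (fun z => fderiv ℝ F z a) (s ×ˢ univ) :=
  (hF.fderiv_of_isOpen (hs.prod isOpen_univ) (by simp)).clm_apply contDiffOn_const

lemma ContDiffOn.section_fderiv_of_isOpen (hs : IsOpen s) (hF : ContDiffOn ℝ ∞ F (s ×ˢ univ))
    {t : ℝ} (ht : t ∈ s) (x ξ : Space d) :
    fderiv ℝ (fun y => F (t, y)) x ξ = fderiv ℝ F (t, x) (0, ξ) := by
  rw [hF.section_fderiv ht, fderivWithin_of_isOpen (hs.prod isOpen_univ) ⟨ht, mem_univ _⟩]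

lemma ContDiffOn.section_hasDerivAt (hs : IsOpen s) (hF : ContDiffOn ℝ ∞ F (s ×ˢ univ))
    {t : ℝ} (ht : t ∈ s) (x : Space d) :
    HasDerivAt (fun τ => F (τ, x)) (fderiv ℝ F (t, x) (1, 0)) t := by
  have h1 : DifferentiableAt ℝ F (t, x) := (hF.contDiffAt
    ((hs.prod isOpen_univ).mem_nhds ⟨ht, mem_univ _⟩)).differentiableAt (by simp)
  exact h1.hasFDerivAt.comp_hasDerivAt t ((hasDerivAt_id t).prodMk (hasDerivAt_const t x))

/-- `∂_t ∂_ξ F = ∂_ξ ∂_t F`. -/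
lemma ContDiffOn.section_fderiv_hasDerivAt (hs : IsOpen s) (hF : ContDiffOn ℝ ∞ F (s ×ˢ univ))
    {t : ℝ} (ht : t ∈ s) (x ξ : Space d) :
    HasDerivAt (fun τ => fderiv ℝ (fun y => F (τ, y)) x ξ)
      (fderiv ℝ (fun y => fderiv ℝ F (t, y) (1, 0)) x ξ) t := by
  have h1 := (hF.contDiffOn_fderiv_apply hs (0, ξ)).section_hasDerivAt hs ht x
  have h2 := (hF.contDiffOn_fderiv_apply hs (1, 0)).section_fderiv_of_isOpen hs ht x ξ
  have hat : ContDiffAt ℝ 2 F (t, x) := (hF.contDiffAt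
    ((hs.prod isOpen_univ).mem_nhds ⟨ht, mem_univ _⟩)).of_le ENat.LEInfty.out
  rw [h2, fderiv_fderiv_comm hat]
  refine h1.congr_of_eventuallyEq ?_
  filter_upwards [hs.mem_nhds ht] with τ hτ
  exact hF.section_fderiv_of_isOpen hs hτ x ξ

lemma ContDiffOn.contDiffOn_section_laplacian (hs : IsOpen s)
    (hF : ContDiffOn ℝ ∞ F (s ×ˢ univ)) :
    ContDiffOn ℝ ∞ (fun z : ℝ × Space d => Δ (fun y => F (z.1, y)) z.2) (s ×ˢ univ) := by
  have h : ContDiffOn ℝ ∞ (fun z => ∑ i : Fin d, fderiv ℝ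
      (fun z => fderiv ℝ F z (0, EuclideanSpace.single i 1)) z (0, EuclideanSpace.single i 1))
      (s ×ˢ univ) :=
    ContDiffOn.sum fun i _ => (hF.contDiffOn_fderiv_apply hs _).contDiffOn_fderiv_apply hs _
  refine h.congr fun z hz => ?_
  rw [laplacian_eq_sum_partialDeriv ((hF.section_contDiff hz.1).of_le ENat.LEInfty.out)]
  refine Finset.sum_congr rfl fun i _ => ?_
  have h2 : _root_.partialDeriv i (fun y => F (z.1, y)) =
      fun y => fderiv ℝ F (z.1, y) (0, EuclideanSpace.single i 1) :=
    funext fun y => hF.section_fderiv_of_isOpen hs hz.1 y _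
  rw [h2]
  exact (hF.contDiffOn_fderiv_apply hs _).section_fderiv_of_isOpen hs hz.1 z.2 _

lemma ContDiffOn.contDiffOn_section_gradient (hs : IsOpen s)
    (hF : ContDiffOn ℝ ∞ F (s ×ˢ univ)) :
    ContDiffOn ℝ ∞ (fun z : ℝ × Space d => ∇ (fun y => F (z.1, y)) z.2) (s ×ˢ univ) := by
  have h : ContDiffOn ℝ ∞ (fun z => (InnerProductSpace.toDual ℝ (Space d)).symm
      ((fderiv ℝ F z).comp (ContinuousLinearMap.inr ℝ ℝ (Space d)))) (s ×ˢ univ) :=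
    (InnerProductSpace.toDual ℝ (Space d)).symm.contDiff.comp_contDiffOn
      ((hF.fderiv_of_isOpen (hs.prod isOpen_univ) (by simp)).clm_comp contDiffOn_const)
  refine h.congr fun z hz => ?_
  rw [gradient]
  congr 1
  ext ξ
  simpa using hF.section_fderiv_of_isOpen hs hz.1 z.2 ξ

end Sections

/-! ### Mixed norms of continuous functions -/

/-- The set where the bound fails is open, lattice-invariant and null in the cell, hence null, hence
empty. -/
lemma TorusPeriodic.enorm_le_of_eLpNorm_top_le {d : ℕ} {f : Space d → ℝ} (hf : TorusPeriodic f)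
    (hc : Continuous f) {U : ℝ≥0∞} (h : eLpNorm f ⊤ (torusMeasure d) ≤ U) (x : Space d) :
    ‖f x‖ₑ ≤ U := by
  set A : Set (Space d) := {y | U < ‖f y‖ₑ} with hA
  have hAo : IsOpen A := isOpen_lt continuous_const (by fun_prop)
  have h0 : volume (A ∩ unitCell d) = 0 := by
    have h1 : ∀ᵐ y ∂(torusMeasure d), ‖f y‖ₑ ≤ U := by
      rw [eLpNorm_exponent_top] at h
      filter_upwards [enorm_ae_le_eLpNormEssSup f (torusMeasure d)] with y hy using hy.trans h
    rw [← Measure.restrict_apply hAo.measurableSet]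
    refine (measure_mono_null ?_ (ae_iff.1 h1) :)
    exact fun y hy => not_le.2 hy
  have h1 : volume A = 0 := by
    refine (isAddFundamentalDomain_unitCell d).measure_zero_of_invariant A (fun g => ?_) h0
    ext y
    rw [mem_vadd_set_iff_neg_vadd_mem]
    have := hf.add_lattice (-g).2 y
    simp only [hA, mem_ofPred_eq]
    rw [show -g +ᵥ y = ((-g : stdLattice d) : Space d) + y from rfl, this]
  have h2 : A = ∅ := (hAo.measure_eq_zero_iff volume).1 h1
  by_contra! hx
  exact (h2 ▸ (show x ∈ A from hx) : x ∈ (∅ : Set (Space d)))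

/-- The bound holds for almost every time, hence on a dense set of times; Fatou along a sequence of
such times gives it at every interior time. -/
lemma eLpNorm_le_mixedNorm {d : ℕ} {T : ℝ} {p : ℝ≥0∞} {f : ℝ → Space d → ℝ}
    (hf : ContinuousOn (fun z : ℝ × Space d => f z.1 z.2) (Ioo 0 T ×ˢ univ)) {t : ℝ}
    (ht : t ∈ Ioo 0 T) : eLpNorm (f t) p (torusMeasure d) ≤ mixedNorm T p f := by
  have hae : ∀ᵐ s : ℝ, s ∈ Ioo 0 T → eLpNorm (f s) p (torusMeasure d) ≤ mixedNorm T p f :=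
    (ae_restrict_iff' measurableSet_Ioo).1 (ENNReal.ae_le_essSup _)
  have hsec : ∀ s ∈ Ioo 0 T, Continuous (f s) := fun s hs => by
    rw [← continuousOn_univ]
    exact hf.comp (f := fun x => (s, x)) (by fun_prop) fun x _ => ⟨hs, mem_univ _⟩
  have hcl := (Measure.dense_of_ae hae).open_subset_closure_inter isOpen_Ioo ht
  obtain ⟨τ, hτ, hlim⟩ := mem_closure_iff_seq_limit.1 hcl
  refine (Lp.eLpNorm_lim_le_liminf_eLpNorm (f := fun n => f (τ n))
    (fun n => (hsec _ (hτ n).1).aestronglyMeasurable) (f t)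
    (Eventually.of_forall fun x => ?_)).trans ?_
  · have h1 : ContinuousWithinAt (fun s => f s x) (Ioo 0 T) t :=
      (hf (t, x) ⟨ht, mem_univ _⟩).comp (f := fun s => (s, x))
        (Continuous.continuousWithinAt (by fun_prop)) fun s hs => ⟨hs, mem_univ _⟩
    exact (h1.continuousAt (isOpen_Ioo.mem_nhds ht)).tendsto.comp hlim
  · refine (liminf_le_liminf (Eventually.of_forall fun n => (hτ n).2 (hτ n).1)).trans ?_
    simp

lemma mixedNorm_top_le {d : ℕ} {T : ℝ} {F : Type*} [NormedAddCommGroup F]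
    {f : ℝ → Space d → F} {C : ℝ} (h : ∀ t ∈ Ioo 0 T, ∀ x, ‖f t x‖ ≤ C) :
    mixedNorm T ⊤ f ≤ ENNReal.ofReal C := by
  refine essSup_le_of_ae_le _ ?_
  refine (ae_restrict_iff' measurableSet_Ioo).2 (Eventually.of_forall fun t ht => ?_)
  have := eLpNorm_le_of_ae_bound (p := ⊤) (μ := torusMeasure d)
    (Eventually.of_forall fun x => h t ht x)
  simpa using this

/-! ### The regularized coupling -/

lemma IsSymmMollifier.hasCompactSupport_scaledKernel {d : ℕ} {η : Space d → ℝ}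
    (hη : IsSymmMollifier η) {ε : ℝ} (hε : 0 < ε) : HasCompactSupport (scaledKernel η ε) := by
  have h1 : HasCompactSupport η :=
    HasCompactSupport.of_support_subset_isCompact (isCompact_closedBall 0 1) hη.support
  exact (h1.comp_smul (inv_ne_zero hε.ne')).mul_left

lemma IsSymmMollifier.continuous_scaledKernel {d : ℕ} {η : Space d → ℝ}
    (hη : IsSymmMollifier η) (ε : ℝ) : Continuous (scaledKernel η ε) := by
  have := hη.smooth.continuous
  unfold scaledKernel
  fun_prop

lemma IsSymmMollifier.scaledKernel_nonneg {d : ℕ} {η : Space d → ℝ}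
    (hη : IsSymmMollifier η) {ε : ℝ} (hε : 0 < ε) (x : Space d) : 0 ≤ scaledKernel η ε x :=
  mul_nonneg (by positivity) (hη.nonneg _)

lemma IsSymmMollifier.integral_scaledKernel {d : ℕ} {η : Space d → ℝ}
    (hη : IsSymmMollifier η) {ε : ℝ} (hε : 0 < ε) : ∫ x, scaledKernel η ε x = 1 := by
  unfold scaledKernel
  rw [integral_const_mul, Measure.integral_comp_smul, hη.integral, finrank_euclideanSpace_fin,
    inv_pow, inv_inv, abs_of_pos (by positivity)]
  simp [hε.ne']

lemma le_convolution {d : ℕ} {K f : Space d → ℝ} (hK : Continuous K) (hKs : HasCompactSupport K)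
    (hK0 : ∀ x, 0 ≤ K x) (hK1 : ∫ x, K x = 1) (hf : Continuous f) {c : ℝ} (hc : ∀ x, c ≤ f x)
    (x : Space d) : c ≤ (K ⋆ f) x := by
  rw [convolution_def]
  calc c = ∫ y, K y * c := by rw [integral_mul_const, hK1, one_mul]
    _ ≤ ∫ y, K y * f (x - y) := by
      refine integral_mono ((hK.mul continuous_const).integrable_of_hasCompactSupport hKs.mul_right)
        ((hK.mul (by fun_prop)).integrable_of_hasCompactSupport hKs.mul_right) fun y => ?_
      exact mul_le_mul_of_nonneg_left (hc _) (hK0 y)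
    _ = _ := rfl

lemma TorusPeriodic.convolution {d : ℕ} {K f : Space d → ℝ} (hf : TorusPeriodic f) :
    TorusPeriodic (K ⋆ f) := by
  intro i x
  simp only [convolution_def]
  refine integral_congr_ae (Eventually.of_forall fun y => ?_)
  simp only
  rw [← hf i (x - y), sub_add_eq_add_sub]

lemma TorusPeriodic.regCoupling {d : ℕ} {η : Space d → ℝ} {g : ℝ → ℝ} {ε : ℝ} {m : Space d → ℝ}
    (hm : TorusPeriodic m) : TorusPeriodic (regCoupling η g ε m) := by
  unfold _root_.regCoupling
  split_ifs
  · exact fun i x => by simp only [hm i x]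
  · exact TorusPeriodic.convolution fun i x => by simp only [hm.convolution i x]

/-- Averaging against a probability kernel preserves lower bounds, so each of the two convolutions
does, and `z^α` is monotone in between. -/
lemma IsPowerCoupling.rpow_le_regCoupling {d : ℕ} {η : Space d → ℝ} (hη : IsSymmMollifier η)
    {g : ℝ → ℝ} {α : ℝ} (hg : IsPowerCoupling g α) {ε : ℝ} (hε : 0 ≤ ε) {m : Space d → ℝ}
    (hm : Continuous m) {c : ℝ} (hc : 0 ≤ c) (hcm : ∀ x, c ≤ m x) (x : Space d) :
    c ^ α ≤ regCoupling η g ε m x := by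
  have hα := hg.1
  unfold regCoupling
  split_ifs with h0
  · change c ^ α ≤ g (m x)
    rw [hg.2 _ (hc.trans (hcm x))]
    exact Real.rpow_le_rpow hc (hcm x) hα.le
  · have hε' : 0 < ε := lt_of_le_of_ne hε (Ne.symm h0)
    have hKc := hη.continuous_scaledKernel ε
    have hKs := hη.hasCompactSupport_scaledKernel hε'
    have hK0 := hη.scaledKernel_nonneg hε'
    have hK1 := hη.integral_scaledKernel hε'
    have h1 := le_convolution hKc hKs hK0 hK1 hm hcm
    have h2 : Continuous (scaledKernel η ε ⋆ m) :=
      hKs.continuous_convolution_left _ hKc hm.locallyIntegrable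
    have h3 : (fun x => g ((scaledKernel η ε ⋆ m) x)) = fun x => (scaledKernel η ε ⋆ m) x ^ α :=
      funext fun y => hg.2 _ (hc.trans (h1 y))
    rw [h3]
    exact le_convolution hKc hKs hK0 hK1 (h2.rpow_const fun y => Or.inr hα.le)
      (fun y => Real.rpow_le_rpow hc (h1 y) hα.le) x

/-- A lower bound on the mixed norm of the coupling, coming from the initial density. -/
lemma rpow_le_mixedNorm_regCoupling {d : ℕ} {η : Space d → ℝ} (hη : IsSymmMollifier η)
    {g : ℝ → ℝ} {α : ℝ} (hg : IsPowerCoupling g α) {ε : ℝ} (hε : 0 ≤ ε) {T : ℝ} (hT : 0 < T)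
    {m : ℝ → Space d → ℝ} (hmp : ∀ t ∈ Icc 0 T, TorusPeriodic (m t))
    (hm : ContinuousOn (fun z : ℝ × Space d => m z.1 z.2) (Icc 0 T ×ˢ univ)) {κ : ℝ} (hκ : 0 < κ)
    (hm0 : ∀ x, κ ≤ m 0 x) {p : ℝ≥0∞} (hp : p ≠ 0) :
    ENNReal.ofReal ((κ / 2) ^ α) ≤ mixedNorm T p (fun t => regCoupling η g ε (m t)) := by
  -- Compactness of the cell makes the lower bound uniform in `x` for short times. How short depends
  -- on the solution, which does not matter: an essential supremum needs only some interval of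
  -- positive length.
  have h1 : ∀ᶠ t in 𝓝 (0 : ℝ), ∀ x ∈ closedCell d, t ∈ Icc 0 T → κ / 2 ≤ m t x := by
    refine (isCompact_closedCell d).eventually_forall_of_forall_eventually fun x _ => ?_
    have h2 := hm (0, x) ⟨left_mem_Icc.2 hT.le, mem_univ _⟩
    have h3 : ∀ᶠ z : ℝ × Space d in 𝓝[Icc 0 T ×ˢ univ] (0, x), κ / 2 < m z.1 z.2 :=
      h2.eventually (lt_mem_nhds (by linarith [hm0 x]))
    rw [eventually_nhdsWithin_iff] at h3
    filter_upwards [h3] with z hz ht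
    exact (hz ⟨ht, mem_univ _⟩).le
  obtain ⟨δ, hδ, h2⟩ := Metric.eventually_nhds_iff_ball.1 h1
  by_contra! hlt
  have hae := ae_lt_of_essSup_lt hlt
  rw [ae_restrict_iff' measurableSet_Ioo] at hae
  have hpos : volume (Ioo 0 (min δ T)) ≠ 0 := by
    simp [hδ, hT]
  have hnull : volume (Ioo 0 (min δ T)) = 0 := by
    refine measure_mono_null ?_ (ae_iff.1 hae)
    intro t ht hcon
    have htT : t ∈ Ioo 0 T := ⟨ht.1, ht.2.trans_le (min_le_right _ _)⟩
    refine absurd (hcon htT) (not_lt.2 ?_)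
    have htI : t ∈ Icc 0 T := Ioo_subset_Icc_self htT
    have hmc : Continuous (m t) := by
      rw [← continuousOn_univ]
      exact hm.comp (f := fun x => (t, x)) (by fun_prop) fun x _ => ⟨htI, mem_univ _⟩
    have hball : t ∈ Metric.ball 0 δ := by
      rw [Metric.mem_ball, dist_zero_right, Real.norm_of_nonneg ht.1.le]
      exact ht.2.trans_le (min_le_left _ _)
    have hlow : ∀ x, κ / 2 ≤ m t x := fun x => by
      obtain ⟨y, hy, hyx⟩ := (hmp t htI).exists_mem_unitCell x
      rw [← hyx]
      exact h2 t hball y (unitCell_subset_closedCell d hy) htI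
    have hG := hg.rpow_le_regCoupling hη hε hmc (by positivity) hlow
    calc ENNReal.ofReal ((κ / 2) ^ α)
        = eLpNorm (fun _ : Space d => (κ / 2) ^ α) p (torusMeasure d) := by
          rw [eLpNorm_const _ hp (NeZero.ne _), measure_univ, ENNReal.one_rpow, mul_one,
            Real.enorm_of_nonneg (by positivity)]
      _ ≤ _ := by
          refine eLpNorm_mono fun x => ?_
          rw [Real.norm_of_nonneg (by positivity)]
          exact (hG x).trans (le_abs_self _)
  exact hpos hnull

/-! ### The differentiated Hamilton-Jacobi equation -/

section Solution

variable {d : ℕ} {H : Space d → Space d → ℝ} {g : ℝ → ℝ} {uT m0 : Space d → ℝ} {T : ℝ}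
  {η : Space d → ℝ} {ε : ℝ} {u m : ℝ → Space d → ℝ}

lemma IsRegMFGSolution.contDiffOn_interior (hu : IsRegMFGSolution H g uT m0 T η ε u m) :
    ContDiffOn ℝ ∞ (fun z : ℝ × Space d => u z.1 z.2) (Ioo 0 T ×ˢ univ) :=
  hu.u_smooth.mono (prod_mono Ioo_subset_Icc_self subset_rfl)

/-- Smoothness is read off the Hamilton-Jacobi equation, where every other term is smooth; `z ↦ z^α`
need not be smooth at zeros of the density. -/
lemma IsRegMFGSolution.contDiffOn_coupling (hu : IsRegMFGSolution H g uT m0 T η ε u m)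
    (hH : IsConvexHamiltonian H) :
    ContDiffOn ℝ ∞ (fun z : ℝ × Space d => regCoupling η g ε (m z.1) z.2) (Ioo 0 T ×ˢ univ) := by
  have hF := hu.contDiffOn_interior
  have h1 := hF.contDiffOn_fderiv_apply isOpen_Ioo (1, 0)
  have h2 := hF.contDiffOn_section_laplacian isOpen_Ioo
  have h3 : ContDiffOn ℝ ∞ (fun z : ℝ × Space d => H z.2 (∇ (u z.1) z.2)) (Ioo 0 T ×ˢ univ) :=
    hH.smooth.comp_contDiffOn (contDiffOn_snd.prodMk (hF.contDiffOn_section_gradient isOpen_Ioo))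
  refine ((h3.sub h1).sub h2).congr fun z hz => ?_
  have h4 := hu.hamiltonJacobi z.1 hz.1 z.2
  rw [(hF.section_hasDerivAt isOpen_Ioo hz.1 z.2).deriv] at h4
  simp only
  linarith

lemma IsRegMFGSolution.differentiated_equation (hu : IsRegMFGSolution H g uT m0 T η ε u m)
    (hH : IsConvexHamiltonian H) {t : ℝ} (ht : t ∈ Ioo 0 T) (x ξ : Space d) :
    -fderiv ℝ (fun y => fderiv ℝ (fun z : ℝ × Space d => u z.1 z.2) (t, y) (1, 0)) x ξ +
      (inner ℝ (gradX H x (∇ (u t) x)) ξ +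
        fderiv ℝ (fun y => fderiv ℝ (u t) y ξ) x (gradP H x (∇ (u t) x))) =
      Δ (fun y => fderiv ℝ (u t) y ξ) x + fderiv ℝ (regCoupling η g ε (m t)) x ξ := by
  have hF := hu.contDiffOn_interior
  have hut : ContDiff ℝ ∞ (u t) := hF.section_contDiff ht
  have hτ : ContDiff ℝ ∞ fun y => fderiv ℝ (fun z : ℝ × Space d => u z.1 z.2) (t, y) (1, 0) :=
    (hF.contDiffOn_fderiv_apply isOpen_Ioo (1, 0)).section_contDiff ht
  have hG : ContDiff ℝ ∞ (regCoupling η g ε (m t)) :=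
    (hu.contDiffOn_coupling hH).section_contDiff ht
  have hHu : ContDiff ℝ ∞ fun y => H y (∇ (u t) y) :=
    hH.smooth.comp (contDiff_id.prodMk (contDiff_gradient hut (by simp)))
  have hΔ : ContDiff ℝ ∞ (Δ (u t)) := (hF.contDiffOn_section_laplacian isOpen_Ioo).section_contDiff ht
  have heq : (fun y => -fderiv ℝ (fun z : ℝ × Space d => u z.1 z.2) (t, y) (1, 0) +
      H y (∇ (u t) y)) = fun y => Δ (u t) y + regCoupling η g ε (m t) y := funext fun y => by
    have h4 := hu.hamiltonJacobi t ht y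
    rwa [(hF.section_hasDerivAt isOpen_Ioo ht y).deriv] at h4
  have hn : (∞ : ℕ∞ω) ≠ 0 := by simp
  have h := congrArg (fun f => fderiv ℝ f x ξ) heq
  rw [fderiv_fun_add (hτ.differentiable hn x).fun_neg (hHu.differentiable hn x),
    fderiv_fun_add (hΔ.differentiable hn x) (hG.differentiable hn x), fderiv_fun_neg,
    add_apply, add_apply, neg_apply,
    fderiv_hamiltonian_comp hH.smooth (hut.of_le ENat.LEInfty.out),
    fderiv_laplacian (hut.of_le ENat.LEInfty.out)] at h
  exact h

/-- The combination of a directional derivative and of the solution itself to which the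
maximum estimate applies. -/
lemma IsRegMFGSolution.isBackwardSubsolution (hu : IsRegMFGSolution H g uT m0 T η ε u m)
    (hH : IsConvexHamiltonian H) (hT : 0 < T) {p c CL C₁ K l θ LT BT N : ℝ} (hc : 0 < c)
    (hL : ∀ x q, c * H x q - CL ≤ inner ℝ (gradP H x q) q - H x q)
    (hX : ∀ x q, ‖gradX H x q‖ ≤ C₁ * H x q)
    (hK : 0 < K)
    (hP : ∀ t ∈ Ioo 0 T, ∀ x, ‖gradP H x (∇ (u t) x)‖ ^ 2 ≤ K * H x (∇ (u t) x))
    (hl : 0 < l) (hlC : 2 * C₁ ≤ l * c) (hθ : θ = 2 * K / (l * c))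
    (hLT : ∀ x, ‖fderiv ℝ uT x‖ ≤ LT) (hBT : ∀ x, |uT x| ≤ BT)
    (hG0 : ∀ t ∈ Ioo 0 T, ∀ x, 0 ≤ regCoupling η g ε (m t) x)
    (hGN : ∀ t ∈ Ioo 0 T, eLpNorm (regCoupling η g ε (m t)) (ENNReal.ofReal p) (torusMeasure d) ≤
      ENNReal.ofReal N) (hθN : θ * N ≤ 1) {ξ : Space d} (hξ : ‖ξ‖ ≤ 1) :
    IsBackwardSubsolution T p ξ
      (fun t x => θ * (fderiv ℝ (u t) x ξ - l * u t x - (LT + l * BT) - l * CL * (T - t)))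
      (fun t x => θ *
        (fderiv ℝ (fun y => fderiv ℝ (fun z : ℝ × Space d => u z.1 z.2) (t, y) (1, 0)) x ξ -
          l * fderiv ℝ (fun z : ℝ × Space d => u z.1 z.2) (t, x) (1, 0) + l * CL))
      (fun t x => θ * regCoupling η g ε (m t) x) := by
  have hF := hu.contDiffOn_interior
  have hθ0 : 0 < θ := by rw [hθ]; positivity
  have hn : (∞ : ℕ∞ω) ≠ 0 := by simp
  have hut : ∀ t ∈ Ioo 0 T, ContDiff ℝ ∞ (u t) := fun t ht => hF.section_contDiff ht
  have hv : ∀ t ∈ Ioo 0 T, ContDiff ℝ ∞ (fun x => fderiv ℝ (u t) x ξ) := fun t ht =>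
    contDiff_fderiv_apply (hut t ht) (by simp) ξ
  refine ⟨?_, ?_, ?_, ?_, ?_, ?_, ?_, ?_, ?_, ?_⟩
  · intro t ht i x
    have hp := hu.u_periodic t (Ioo_subset_Icc_self ht)
    simp only [hp i x, hp.fderiv i x]
  · intro t ht
    have h1 := (hv t ht).of_le (m := 2) ENat.LEInfty.out
    have h2 := (hut t ht).of_le (m := 2) ENat.LEInfty.out
    fun_prop
  · intro t ht i x
    simp only [(hu.m_periodic t (Ioo_subset_Icc_self ht)).regCoupling i x]
  · intro t ht
    have h1 : ContDiff ℝ 1 (regCoupling η g ε (m t)) :=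
      ((hu.contDiffOn_coupling hH).section_contDiff ht).of_le ENat.LEInfty.out
    fun_prop
  · have h1 := (ContDiffOn.continuousOn_section_fderiv (uniqueDiffOn_Icc hT) hu.u_smooth ξ).mono
      (prod_mono Ioc_subset_Icc_self subset_rfl)
    have h2 := hu.u_smooth.continuousOn.mono (prod_mono Ioc_subset_Icc_self subset_rfl)
    fun_prop
  · intro t ht x
    have h1 := hF.section_fderiv_hasDerivAt isOpen_Ioo ht x ξ
    have h2 := hF.section_hasDerivAt isOpen_Ioo ht x
    have h3 : HasDerivAt (fun s => l * CL * (T - s)) (l * CL * (-1)) t :=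
      ((hasDerivAt_id t).const_sub T).const_mul _
    exact ((((h1.sub (h2.const_mul l)).sub_const (LT + l * BT)).sub h3).const_mul θ).congr_deriv
      (by ring)
  · have h1 := (hF.contDiffOn_fderiv_apply isOpen_Ioo (1, 0)).continuousOn
    have h2 : ContinuousOn (fun z : ℝ × Space d => fderiv ℝ (fun y => fderiv ℝ
        (fun z : ℝ × Space d => u z.1 z.2) (z.1, y) (1, 0)) z.2 ξ) (Ioo 0 T ×ˢ univ) :=
      (hF.contDiffOn_fderiv_apply isOpen_Ioo (1, 0)).continuousOn_section_fderiv
        isOpen_Ioo.uniqueDiffOn ξ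
    fun_prop
  · intro x
    have huT : u T = uT := funext hu.terminal
    simp only [huT, sub_self, mul_zero, sub_zero]
    refine mul_nonpos_of_nonneg_of_nonpos hθ0.le ?_
    have h1 : fderiv ℝ uT x ξ ≤ LT := (le_abs_self _).trans
      (((fderiv ℝ uT x).le_opNorm ξ).trans
        ((mul_le_of_le_one_right (norm_nonneg _) hξ).trans (hLT x)))
    have h2 := mul_le_mul_of_nonneg_left ((neg_le_abs _).trans (hBT x)) hl.le
    linarith
  · intro t ht x
    set v : Space d → ℝ := fun y => fderiv ℝ (u t) y ξ with hvdef
    -- The constant makes `w ≤ 0` at time `T`; the term linear in time cancels the constant `CL` of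
    -- the Lagrangian bound.
    set w : Space d → ℝ := fun y => v y - l * u t y - (LT + l * BT) - l * CL * (T - t) with hw
    have hv2 : ContDiff ℝ 2 v := (hv t ht).of_le ENat.LEInfty.out
    have hu2 : ContDiff ℝ 2 (u t) := (hut t ht).of_le ENat.LEInfty.out
    have hw2 : ContDiff ℝ 2 w := by fun_prop
    have hfw : fderiv ℝ w = fun y => fderiv ℝ v y - l • fderiv ℝ (u t) y := by
      ext1 y
      rw [hw, fderiv_sub_const, fderiv_sub_const, fderiv_fun_sub (hv2.differentiable (by simp) y)
        ((hu2.differentiable (by simp) y).const_mul l),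
        fderiv_const_mul (hu2.differentiable (by simp) y)]
    have hΔw : Δ w x = Δ v x - l * Δ (u t) x := by
      have e : ∀ i, _root_.partialDeriv i w =
          fun y => _root_.partialDeriv i v y - l * _root_.partialDeriv i (u t) y := fun i => by
        ext y
        simp [_root_.partialDeriv, hfw]
      rw [laplacian_eq_sum_partialDeriv hw2, laplacian_eq_sum_partialDeriv hv2,
        laplacian_eq_sum_partialDeriv hu2, Finset.mul_sum, ← Finset.sum_sub_distrib]
      refine Finset.sum_congr rfl fun i _ => ?_
      have d1 := (hv2.partialDeriv i).differentiable (by simp) x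
      have d2 := (hu2.partialDeriv i).differentiable (by simp) x
      rw [e i, _root_.partialDeriv, fderiv_fun_sub d1 (d2.const_mul l), fderiv_const_mul d2]
      simp [_root_.partialDeriv]
    have hΔθ : Δ (fun y => θ * w y) x = θ * Δ w x := by
      have := InnerProductSpace.laplacian_smul θ (hw2.contDiffAt (x := x))
      simpa [Pi.smul_def] using this
    have hfθ : fderiv ℝ (fun y => θ * w y) x = θ • fderiv ℝ w x :=
      fderiv_const_mul (hw2.differentiable (by simp) x) θ
    have hG1 : ContDiff ℝ ∞ (regCoupling η g ε (m t)) :=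
      (hu.contDiffOn_coupling hH).section_contDiff ht
    have hfG : fderiv ℝ (fun y => θ * regCoupling η g ε (m t) y) x =
        θ • fderiv ℝ (regCoupling η g ε (m t)) x :=
      fderiv_const_mul (hG1.differentiable hn x) θ
    rw [hΔθ, hfθ, hfG, hΔw]
    have e1 := hu.hamiltonJacobi t ht x
    rw [(hF.section_hasDerivAt isOpen_Ioo ht x).deriv] at e1
    have e2 := hu.differentiated_equation hH ht x ξ
    rw [← hvdef] at e2
    set q := ∇ (u t) x with hq
    set b := gradP H x q with hb
    set h := H x q
    have hh1 : 1 ≤ h := hH.one_le x q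
    have e3 : fderiv ℝ w x b = fderiv ℝ v x b - l * inner ℝ b q := by
      rw [hfw, real_inner_comm, hq, inner_gradient_left]
      simp
    have e4 : -(C₁ * h) ≤ inner ℝ (gradX H x q) ξ := by
      have h1 := abs_real_inner_le_norm (gradX H x q) ξ
      have h2 := mul_le_of_le_one_right (norm_nonneg (gradX H x q)) hξ
      have h3 := neg_abs_le (inner ℝ (gradX H x q) ξ)
      linarith [hX x q]
    -- Young on the transport term, with `|b|² ≤ K h`.
    have e5 : -(θ * fderiv ℝ w x b) ≤ 1 / 4 * ‖θ • fderiv ℝ w x‖ ^ 2 + K * h := by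
      have h1 : |(θ • fderiv ℝ w x) b| ≤ ‖θ • fderiv ℝ w x‖ * ‖b‖ :=
        (θ • fderiv ℝ w x).le_opNorm b
      have h2 : (θ • fderiv ℝ w x) b = θ * fderiv ℝ w x b := by simp
      rw [h2] at h1
      have h3 := neg_le_abs (θ * fderiv ℝ w x b)
      nlinarith [hP t ht x, sq_nonneg (‖θ • fderiv ℝ w x‖ / 2 - ‖b‖)]
    have e6 := hL x q
    have e7 : θ * (l * c) = 2 * K := by rw [hθ]; field_simp
    have e8 : 0 ≤ θ * l * regCoupling η g ε (m t) x :=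
      mul_nonneg (mul_nonneg hθ0.le hl.le) (hG0 t ht x)
    have e9 : θ * l * (c * h - CL) ≤ θ * l * (inner ℝ b q - h) :=
      mul_le_mul_of_nonneg_left e6 (by positivity)
    have e10 : θ * -(C₁ * h) ≤ θ * inner ℝ (gradX H x q) ξ :=
      mul_le_mul_of_nonneg_left e4 hθ0.le
    -- Half of the good term `θ l c h = 2K h` pays for `D_xH`, the other half for the `K h` of
    -- Young's inequality.
    have e11 : θ * (2 * C₁ * h) ≤ θ * (l * c * h) := by gcongr
    have e12 : θ * (l * c) * h = 2 * K * h := by rw [e7]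
    have e13 : (θ • fderiv ℝ (regCoupling η g ε (m t)) x) ξ =
        θ * fderiv ℝ (regCoupling η g ε (m t)) x ξ := by simp
    rw [e13]
    have e1' := congrArg (fun r => θ * l * r) e1
    have e2' := congrArg (fun r => θ * r) e2
    have e3' := congrArg (fun r => θ * r) e3
    linarith
  · intro t ht
    have h1 : (fun x => θ * regCoupling η g ε (m t) x) = θ • regCoupling η g ε (m t) := by
      ext; simp
    rw [h1, eLpNorm_const_smul]
    calc _ ≤ ENNReal.ofReal θ * ENNReal.ofReal N := by
          rw [Real.enorm_of_nonneg hθ0.le]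
          gcongr
          exact hGN t ht
      _ ≤ 1 := by
          rw [← ENNReal.ofReal_mul hθ0.le]
          exact ENNReal.ofReal_le_one.2 hθN

/-- A qualitative bound by compactness, depending on the solution. It serves only to make `M = sup
|Du|` finite, so that `M^μ` can be absorbed. -/
lemma IsRegMFGSolution.exists_gradient_bound (hu : IsRegMFGSolution H g uT m0 T η ε u m)
    (hT : 0 < T) : ∃ B, ∀ t ∈ Icc 0 T, ∀ x, ‖∇ (u t) x‖ ≤ B := by
  have hc := hu.u_smooth.continuousOn_fderivWithin ((uniqueDiffOn_Icc hT).prod uniqueDiffOn_univ)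
    (by simp)
  obtain ⟨B, hB⟩ := (isCompact_Icc.prod (isCompact_closedCell d)).exists_bound_of_continuousOn
    (hc.mono (prod_mono subset_rfl (subset_univ _)))
  refine ⟨B * ‖ContinuousLinearMap.inr ℝ ℝ (Space d)‖, fun t ht x => ?_⟩
  obtain ⟨y, hy, hyx⟩ := (hu.u_periodic t ht).fderiv.exists_mem_unitCell x
  have h1 : fderiv ℝ (u t) y = (fderivWithin ℝ (fun z : ℝ × Space d => u z.1 z.2)
      (Icc 0 T ×ˢ univ) (t, y)).comp (ContinuousLinearMap.inr ℝ ℝ (Space d)) := by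
    ext ξ
    simpa using hu.u_smooth.section_fderiv ht y ξ
  rw [norm_gradient_eq, ← hyx, h1]
  refine (ContinuousLinearMap.opNorm_comp_le _ _).trans ?_
  exact mul_le_mul_of_nonneg_right (hB (t, y) ⟨ht, unitCell_subset_closedCell d hy⟩)
    (norm_nonneg _)

end Solution

/-! ### Closing the estimate on the supremum of the gradient -/

/-- Absorption of the sublinear power. -/
lemma exists_absorb_rpow {μ L a b A n : ℝ} (hμ : 0 < μ) (hμ1 : μ < 1) (hL : 0 ≤ L) (ha : 0 ≤ a)
    (hb : 0 ≤ b) (hA : 0 ≤ A) (hn : 0 < n) :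
    ∃ C : ℝ, 1 ≤ C ∧ ∀ M N U : ℝ, 0 ≤ M → n ≤ N → 0 ≤ U →
      M ≤ L + (1 + a + b * (1 + M ^ μ) * N) * (U + A) →
      M ≤ C + C * N ^ (1 / (1 - μ)) + C * N ^ (1 / (1 - μ)) * U ^ (1 / (1 - μ)) := by
  set s : ℝ := 1 / (1 - μ) with hs
  have hμ0 : 0 < 1 - μ := by linarith
  have hs0 : 0 < s := by positivity
  -- For `M ≥ 1` one has `N M^μ / n ≥ 1`, so each term without the factor `N M^μ` may be multiplied
  -- by this ratio. This leaves `M ≤ D N M^μ (1 + U)`.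
  set D : ℝ := L / n + ((1 + a) / n + 2 * b) * (1 + A) with hD
  have hD0 : 0 ≤ D := by positivity
  refine ⟨max 1 ((2 * D) ^ s), le_max_left _ _, fun M N U hM hN hU h => ?_⟩
  have hN0 : 0 < N := hn.trans_le hN
  set C := max 1 ((2 * D) ^ s)
  have hC1 : 1 ≤ C := le_max_left _ _
  have hNs : 0 ≤ N ^ s := by positivity
  have hUs : 0 ≤ U ^ s := by positivity
  rcases le_total M 1 with hM1 | hM1
  · have h1 : 0 ≤ C * N ^ s := by positivity
    have h2 : 0 ≤ C * N ^ s * U ^ s := by positivity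
    linarith
  · have hMμ : 1 ≤ M ^ μ := Real.one_le_rpow hM1 hμ.le
    have hMpos : 0 < M := by linarith
    set X := N * M ^ μ with hX
    have hXn : 1 ≤ X / n := by
      rw [le_div_iff₀ hn, one_mul]
      exact hN.trans (le_mul_of_one_le_right hN0.le hMμ)
    have hX0 : 0 < X := by positivity
    have h1 : 1 + a + b * (1 + M ^ μ) * N ≤ ((1 + a) / n + 2 * b) * X := by
      have e1 : (1 + a) * 1 ≤ (1 + a) * (X / n) := by gcongr
      have e2 : b * (1 + M ^ μ) * N ≤ b * (2 * M ^ μ) * N := by gcongr; linarith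
      calc _ ≤ (1 + a) * (X / n) + b * (2 * M ^ μ) * N := by linarith
        _ = _ := by rw [hX]; ring
    have h2 : U + A ≤ (1 + A) * (1 + U) := by nlinarith [mul_nonneg hA hU]
    have h3 : M ≤ D * X * (1 + U) := by
      have e1 : L * 1 ≤ L * (X / n) := by gcongr
      have e2 : L * (X / n) * 1 ≤ L * (X / n) * (1 + U) := by gcongr; linarith
      have e3 : (1 + a + b * (1 + M ^ μ) * N) * (U + A) ≤
          ((1 + a) / n + 2 * b) * X * ((1 + A) * (1 + U)) := by gcongr
      calc M ≤ L * (X / n) * (1 + U) + ((1 + a) / n + 2 * b) * X * ((1 + A) * (1 + U)) := by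
            linarith
        _ = _ := by rw [hD]; ring
    have h4 : M ^ (1 - μ) ≤ D * N * (1 + U) := by
      rw [Real.rpow_sub hMpos, Real.rpow_one, div_le_iff₀ (by positivity)]
      calc M ≤ _ := h3
        _ = _ := by rw [hX]; ring
    have h5 : M ≤ (D * N * (1 + U)) ^ s := by
      have := Real.rpow_le_rpow (by positivity) h4 hs0.le
      rwa [← Real.rpow_mul hM, hs, mul_one_div_cancel hμ0.ne', Real.rpow_one] at this
    have h6 : (1 + U) ^ s ≤ 2 ^ s * (1 + U ^ s) := by
      have e1 : 1 + U ≤ 2 * max 1 U := by linarith [le_max_left 1 U, le_max_right 1 U]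
      calc (1 + U) ^ s ≤ (2 * max 1 U) ^ s := Real.rpow_le_rpow (by positivity) e1 hs0.le
        _ = 2 ^ s * (max 1 U) ^ s := Real.mul_rpow (by norm_num) (by positivity)
        _ ≤ _ := by
          gcongr
          rcases max_cases 1 U with ⟨e, -⟩ | ⟨e, -⟩ <;> rw [e]
          · rw [Real.one_rpow]; linarith
          · linarith
    calc M ≤ (D * N * (1 + U)) ^ s := h5
      _ = D ^ s * N ^ s * (1 + U) ^ s := by
          rw [Real.mul_rpow (by positivity) (by positivity), Real.mul_rpow hD0 hN0.le]
      _ ≤ D ^ s * N ^ s * (2 ^ s * (1 + U ^ s)) := by gcongr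
      _ = (2 * D) ^ s * (N ^ s * (1 + U ^ s)) := by
          rw [Real.mul_rpow (by norm_num) hD0]; ring
      _ ≤ C * (N ^ s * (1 + U ^ s)) := by
          gcongr
          exact le_max_right _ _
      _ ≤ _ := by linarith

lemma exists_finite_exponent {d : ℕ} {p : ℝ≥0∞} (hp : (d : ℝ≥0∞) < p) :
    ∃ r : ℝ, (d : ℝ) < r ∧ ENNReal.ofReal r ≤ p := by
  obtain ⟨r, hr1, hr2⟩ := ENNReal.lt_iff_exists_nnreal_btwn.1 hp
  refine ⟨r, by exact_mod_cast hr1, ?_⟩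
  rw [ENNReal.ofReal_coe_nnreal]
  exact hr2.le

/-- The a priori bound with real constants. -/
lemma exists_gradient_estimate {d : ℕ} (hd : 2 ≤ d)
    {H : Space d → Space d → ℝ} {g : ℝ → ℝ} {uT m0 : Space d → ℝ} {T : ℝ} (hT : 0 < T) {α μ : ℝ}
    {η : Space d → ℝ} (hη : IsSymmMollifier η) (hH : IsConvexHamiltonian H)
    (hData : IsCouplingAndData g uT m0) (hL : LagrangianBound H) (hg : IsPowerCoupling g α)
    (hHx : SpatialDerivativeBounds H) (hm0 : BoundedBelowDensity m0) (hμ : 0 < μ) (hμ1 : μ < 1)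
    (hHp : MomentumGradientBound H μ) {p : ℝ≥0∞} (hp : (d : ℝ≥0∞) < p) :
    ∃ C : ℝ, 1 ≤ C ∧ ∀ ε : ℝ, 0 ≤ ε → ∀ u m : ℝ → Space d → ℝ,
      IsRegMFGSolution H g uT m0 T η ε u m → ∀ N U : ℝ≥0,
      mixedNorm T p (fun t => regCoupling η g ε (m t)) = N → mixedNorm T ⊤ u = U →
      ∀ t ∈ Ioo 0 T, ∀ x, ‖∇ (u t) x‖ ≤ C + C * (N : ℝ) ^ (1 / (1 - μ)) +
        C * (N : ℝ) ^ (1 / (1 - μ)) * (U : ℝ) ^ (1 / (1 - μ)) := by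
  -- The Moser bound takes a finite exponent, while `p` may be `∞`; norms only decrease with the
  -- exponent on a probability space.
  obtain ⟨r, hdr, hrp⟩ := exists_finite_exponent hp
  obtain ⟨β, hβ0, hβ⟩ := exists_backward_subsolution_le hd hdr hT
  obtain ⟨c, CL, hc, hCL, hL⟩ := hL
  obtain ⟨CX, hX⟩ := hHx.space
  obtain ⟨CP, hP⟩ := hHp
  obtain ⟨κ, hκ, hκm⟩ := hm0
  obtain ⟨LT, hLT⟩ := hData.uT_periodic.fderiv.exists_bound
    (hData.uT_smooth.continuous_fderiv (by simp))
  obtain ⟨BT, hBT⟩ := hData.uT_periodic.exists_bound hData.uT_smooth.continuous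
  have hLT0 : 0 ≤ LT := (norm_nonneg _).trans (hLT 0)
  have hBT0 : 0 ≤ BT := (norm_nonneg _).trans (hBT 0)
  set C₁ : ℝ := 2 * |CX| with hC₁
  have hC₁0 : 0 ≤ C₁ := by positivity
  have hX' : ∀ x q, ‖gradX H x q‖ ≤ C₁ * H x q := fun x q => by
    have h1 := (hX x q).1
    have h2 := hH.one_le x q
    have h3 := le_abs_self CX
    have h4 : CX * H x q ≤ |CX| * H x q := by gcongr
    have h5 : |CX| * 1 ≤ |CX| * H x q := by gcongr
    rw [hC₁]
    linarith
  set Cb : ℝ := |CP| + 1 with hCb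
  have hCb1 : 1 ≤ Cb := by rw [hCb]; linarith [abs_nonneg CP]
  obtain ⟨C, hC1, hC⟩ := exists_absorb_rpow (μ := μ) (L := LT) (a := 2 * C₁ / c)
    (b := 2 * Cb / c) (A := BT + CL * T + β * c / 2) (n := (κ / 2) ^ α) hμ hμ1 hLT0
    (by positivity) (by positivity) (by positivity) (by positivity)
  refine ⟨C, hC1, fun ε hε u m hu N U hN hU => ?_⟩
  have hmS := hu.m_smooth.continuousOn
  have hsecm : ∀ t ∈ Icc 0 T, Continuous (m t) := fun t ht =>
    (hu.m_smooth.section_contDiff ht).continuous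
  have hG0 : ∀ t ∈ Ioo 0 T, ∀ x, 0 ≤ regCoupling η g ε (m t) x := fun t ht x => by
    have ht' := Ioo_subset_Icc_self ht
    have := hg.rpow_le_regCoupling hη hε (hsecm t ht') le_rfl (hu.m_nonneg t ht') x
    rwa [Real.zero_rpow hg.1.ne'] at this
  have hGc := (hu.contDiffOn_coupling hH).continuousOn
  have hGN : ∀ t ∈ Ioo 0 T, eLpNorm (regCoupling η g ε (m t)) (ENNReal.ofReal r)
      (torusMeasure d) ≤ ENNReal.ofReal N := fun t ht => by
    refine (eLpNorm_le_eLpNorm_of_exponent_le hrp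
      ((hu.contDiffOn_coupling hH).section_contDiff ht).continuous.aestronglyMeasurable).trans ?_
    refine (eLpNorm_le_mixedNorm (f := fun t => regCoupling η g ε (m t)) hGc ht).trans ?_
    rw [hN, ENNReal.ofReal_coe_nnreal]
  have hlow : (κ / 2) ^ α ≤ N := by
    have h1 := rpow_le_mixedNorm_regCoupling hη hg hε hT hu.m_periodic hmS hκ
      (fun x => by rw [hu.initial x]; exact hκm x) (p := p) (hp.ne_bot)
    rw [hN, ← ENNReal.ofReal_coe_nnreal, ENNReal.ofReal_le_ofReal_iff N.coe_nonneg] at h1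
    exact h1
  have huU : ∀ t ∈ Ioo 0 T, ∀ x, u t x ≤ U := fun t ht x => by
    have h1 := (hu.u_periodic t (Ioo_subset_Icc_self ht)).enorm_le_of_eLpNorm_top_le
      (hu.contDiffOn_interior.section_contDiff ht).continuous
      (eLpNorm_le_mixedNorm hu.contDiffOn_interior.continuousOn ht) x
    rw [hU, enorm_le_coe] at h1
    exact (le_abs_self _).trans (by exact_mod_cast h1)
  obtain ⟨B, hB⟩ := hu.exists_gradient_bound hT
  set S : Set ℝ := {y | ∃ t ∈ Ioo 0 T, ∃ x, y = ‖∇ (u t) x‖} with hS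
  have hSb : BddAbove S := ⟨B, by
    rintro y ⟨t, ht, x, rfl⟩
    exact hB t (Ioo_subset_Icc_self ht) x⟩
  have hSne : S.Nonempty := ⟨_, T / 2, ⟨by linarith, by linarith⟩, 0, rfl⟩
  set M := sSup S with hM
  have hgM : ∀ t ∈ Ioo 0 T, ∀ x, ‖∇ (u t) x‖ ≤ M := fun t ht x => le_csSup hSb ⟨t, ht, x, rfl⟩
  have hM0 : 0 ≤ M := (norm_nonneg _).trans (hgM (T / 2) ⟨by linarith, by linarith⟩ 0)
  suffices h : M ≤ LT + (1 + 2 * C₁ / c + 2 * Cb / c * (1 + M ^ μ) * N) *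
      (U + (BT + CL * T + β * c / 2)) from
    fun t ht x => (hgM t ht x).trans (hC M N U hM0 hlow U.coe_nonneg h)
  set K : ℝ := Cb * (1 + M ^ μ) with hK
  have hMμ : 0 ≤ M ^ μ := by positivity
  have hK1 : 1 ≤ K := by
    rw [hK]
    nlinarith
  have hK0 : 0 < K := by linarith
  -- Chosen so that `l c = c + 2C₁ + 2KN`: the second term controls `D_xH`, and the third gives `θN
  -- ≤ 1` for `θ = 2K/(lc)`.
  set l : ℝ := 1 + 2 * C₁ / c + 2 * Cb / c * (1 + M ^ μ) * N with hl
  have hl0 : 0 < l := by positivity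
  have hlc : l * c = c + 2 * C₁ + 2 * K * N := by
    rw [hl, hK]
    field_simp
  have hKN : 0 ≤ 2 * K * N := by positivity
  have hP' : ∀ t ∈ Ioo 0 T, ∀ x, ‖gradP H x (∇ (u t) x)‖ ^ 2 ≤ K * H x (∇ (u t) x) := by
    intro t ht x
    have h1 := hP x (∇ (u t) x)
    have h2 := hH.one_le x (∇ (u t) x)
    have h3 : ‖∇ (u t) x‖ ^ μ ≤ M ^ μ := Real.rpow_le_rpow (norm_nonneg _) (hgM t ht x) hμ.le
    have h4 : CP ≤ Cb := by rw [hCb]; linarith [le_abs_self CP]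
    calc _ ≤ _ := h1
      _ ≤ Cb * M ^ μ * H x (∇ (u t) x) + Cb * H x (∇ (u t) x) := by
          have h5 : CP * ‖∇ (u t) x‖ ^ μ * H x (∇ (u t) x) ≤ Cb * M ^ μ * H x (∇ (u t) x) := by
            gcongr
          have h6 : Cb * 1 ≤ Cb * H x (∇ (u t) x) := by gcongr
          linarith
      _ = _ := by rw [hK]; ring
  refine csSup_le hSne ?_
  rintro y ⟨t, ht, x, rfl⟩
  set q := ∇ (u t) x with hq
  -- The direction of the gradient at the given point; where the gradient vanishes, `ξ = 0` also
  -- works.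
  set ξ : Space d := ‖q‖⁻¹ • q with hξ
  have hξ1 : ‖ξ‖ ≤ 1 := by
    rw [hξ, norm_smul, norm_inv, norm_norm]
    exact inv_mul_le_one
  have hθN : 2 * K / (l * c) * N ≤ 1 := by
    rw [div_mul_eq_mul_div, div_le_one (by positivity), hlc]
    linarith
  have hsub := hu.isBackwardSubsolution hH hT hc hL hX' hK0 hP' hl0 (by rw [hlc]; linarith)
    (rfl : 2 * K / (l * c) = _) hLT hBT hG0 hGN hθN hξ1
  have hW := hβ ξ _ _ _ hξ1 hsub t ht x
  have hqξ : fderiv ℝ (u t) x ξ = ‖q‖ := by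
    rw [← inner_gradient_left, ← hq, hξ, inner_smul_right, real_inner_self_eq_norm_sq]
    by_cases h0 : ‖q‖ = 0
    · simp [h0]
    · field_simp
  simp only [hqξ] at hW
  rw [div_mul_eq_mul_div, div_le_iff₀ (by positivity)] at hW
  have h1 : l * u t x ≤ l * U := mul_le_mul_of_nonneg_left (huU t ht x) hl0.le
  have h2 : l * CL * (T - t) ≤ l * CL * T := by
    have := ht.1
    gcongr
    linarith
  -- Dividing `W ≤ β` by `θ` gives `β l c / (2K)`; dropping `K ≥ 1` keeps the right side linear in
  -- `l`.
  have h3 : ‖q‖ - l * u t x - (LT + l * BT) - l * CL * (T - t) ≤ β * (l * c) / 2 := by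
    have h4 : 0 ≤ β * (l * c) / 2 := by positivity
    by_contra! hcon
    have h5 : K * (β * (l * c) / 2) < K * (‖q‖ - l * u t x - (LT + l * BT) - l * CL * (T - t)) := by
      gcongr
    have h6 : 1 * (β * (l * c) / 2) ≤ K * (β * (l * c) / 2) := by gcongr
    linarith
  calc ‖q‖ ≤ LT + l * BT + l * CL * T + l * U + β * (l * c) / 2 := by linarith
    _ = _ := by ring

theorem mainTheorem4 (d : ℕ) (hd : 2 ≤ d)
    (H : Space d → Space d → ℝ) (g : ℝ → ℝ) (uT m0 : Space d → ℝ)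
    (T : ℝ) (hT : 0 < T) (α μ : ℝ)
    (η : Space d → ℝ) (hη : IsSymmMollifier η)
    (hH : IsConvexHamiltonian H)
    (hData : IsCouplingAndData g uT m0)
    (hL : LagrangianBound H)
    (hg : IsPowerCoupling g α)
    (hHx : SpatialDerivativeBounds H)
    (hm0 : BoundedBelowDensity m0)
    (hGrowth : SuperquadraticGrowth H μ)
    (hHp : MomentumGradientBound H μ)
    (hHpp : MomentumHessianBounds H μ)
    (p : ℝ≥0∞) (hp : (d : ℝ≥0∞) < p) :
    ∃ C : ℝ≥0, ∀ ε : ℝ, 0 ≤ ε → ∀ u m : ℝ → Space d → ℝ,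
      IsRegMFGSolution H g uT m0 T η ε u m →
      mixedNorm T ∞ (fun t x => ∇ (u t) x) ≤
        C + C * mixedNorm T p (fun t => regCoupling η g ε (m t)) ^ (1 / (1 - μ))
          + C * mixedNorm T p (fun t => regCoupling η g ε (m t)) ^ (1 / (1 - μ))
              * mixedNorm T ∞ u ^ (1 / (1 - μ)) := by
  obtain ⟨hμ, hμ1, -⟩ := hGrowth
  obtain ⟨C, hC1, hC⟩ := exists_gradient_estimate hd hT hη hH hData hL hg hHx hm0 hμ hμ1 hHp hp
  have hC0 : 0 ≤ C := by linarith
  have hs : 0 < 1 / (1 - μ) := one_div_pos.2 (by linarith)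
  lift C to ℝ≥0 using hC0
  refine ⟨C, fun ε hε u m hu => ?_⟩
  -- In `ℝ≥0∞` one has `0 * ⊤ = 0`. The cases of an infinite norm are trivial only because `C` and
  -- the norm of the coupling are nonzero.
  have hCne : (C : ℝ≥0∞) ≠ 0 := by
    have : (1 : ℝ≥0) ≤ C := by exact_mod_cast hC1
    exact_mod_cast (zero_lt_one.trans_le this).ne'
  obtain ⟨κ, hκ, hκm⟩ := hm0
  have hlow := rpow_le_mixedNorm_regCoupling hη hg hε hT hu.m_periodic hu.m_smooth.continuousOn hκ
    (fun x => by rw [hu.initial x]; exact hκm x) (p := p) hp.ne_bot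
  have hNne : mixedNorm T p (fun t => regCoupling η g ε (m t)) ≠ 0 := fun h0 => by
    rw [h0, nonpos_iff_eq_zero, ENNReal.ofReal_eq_zero] at hlow
    exact absurd hlow (not_le.2 (by positivity))
  by_cases hNtop : mixedNorm T p (fun t => regCoupling η g ε (m t)) = ⊤
  · rw [hNtop, ENNReal.top_rpow_of_pos hs, ENNReal.mul_top hCne]
    simp
  by_cases hUtop : mixedNorm T ⊤ u = ⊤
  · rw [hUtop, ENNReal.top_rpow_of_pos hs, ENNReal.mul_top]
    · simp
    · exact mul_ne_zero hCne (by simp [ENNReal.rpow_eq_zero_iff, hNne, hNtop])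
  obtain ⟨N, hN⟩ := WithTop.ne_top_iff_exists.1 hNtop
  obtain ⟨U, hU⟩ := WithTop.ne_top_iff_exists.1 hUtop
  refine (mixedNorm_top_le (hC ε hε u m hu N U hN.symm hU.symm)).trans (le_of_eq ?_)
  rw [← hN, ← hU, ENNReal.ofReal_add (by positivity) (by positivity),
    ENNReal.ofReal_add (by positivity) (by positivity), ENNReal.ofReal_mul (by positivity),
    ENNReal.ofReal_mul (by positivity), ENNReal.ofReal_mul (by positivity),
    ← ENNReal.ofReal_rpow_of_nonneg N.coe_nonneg hs.le, ← ENNReal.ofReal_rpow_of_nonneg U.coe_nonneg hs.le,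
    ENNReal.ofReal_coe_nnreal, ENNReal.ofReal_coe_nnreal, ENNReal.ofReal_coe_nnreal]
  rfl
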